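/- Let $C\in\mathbb{C}$, let $p$ and $q$ be complex polynomials with $p\not\equiv 0$ and $\deg q>0$, and let $$f(z)=C+\int_0^z p(w)e^{q(w)}\,dw .$$ Let $\operatorname{SV}(f)\subset\mathbb{C}$ be the set of finite singular values of $f$, i.e. the closure of the set of its critical values and finite asymptotic values (limits of $f$ along paths tending to $\infty$). For an open set $D\supset\operatorname{SV}(f)$ and $\rho>0$ put $$I_1(\rho,D)=\frac1{2\pi}\iint_{\{z\,:\,|z|\ge\rho,\ |f(z)|\le\rho,\ f(z)\notin D\}}\frac{dx\,dy}{|z|^2}\in[0,\infty].$$ Then $f$ is a transcendental entire function with bounded set $\operatorname{SV}(f)$, and it has the asymptotic area property: for every open set $D\supset\operatorname{SV}(f)$, $$\limsup_{\rho\to\infty} I_1(\rho,D)<\infty .$$ Moreover, for every $0<\kappa<1$, the function $\rho\mapsto\rho^{-\kappa}$ is a degeneration function for $f$: for every open set $D\supset\operatorname{SV}(f)$, $$\limsup_{\rho\to\infty}\frac{I_1(\rho,D)}{\rho^{-\kappa}}<\infty .$$ -/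

import Mathlib

open MeasureTheory Filter Topology
open scoped ENNReal Polynomial

namespace StructFinite

/-- The entire function `z ↦ C + ∫₀ᶻ p(w) e^{q(w)} dw`. The integrand is entire, so the integral does
not depend on the path; it is taken along the segment `w = t z`, `0 ≤ t ≤ 1`. -/
noncomputable def primitiveFn (C : ℂ) (p q : ℂ[X]) (z : ℂ) : ℂ :=
  C + ∫ t in (0 : ℝ)..1, p.eval ((t : ℂ) * z) * Complex.exp (q.eval ((t : ℂ) * z)) * z

/-- `f` is structurally finite. The condition `p ≠ 0` says that `f` is not constant. -/
def IsStructurallyFinite (f : ℂ → ℂ) : Prop :=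
  ∃ (C : ℂ) (p q : ℂ[X]), p ≠ 0 ∧ 0 < q.natDegree ∧ ∀ z, f z = primitiveFn C p q z

/-- `f` is an entire function that is not a polynomial. -/
def IsTranscendentalEntire (f : ℂ → ℂ) : Prop :=
  Differentiable ℂ f ∧ ¬ ∃ P : ℂ[X], ∀ z, f z = P.eval z

/-- The critical values of `f`: images of the critical points. -/
def criticalValues (f : ℂ → ℂ) : Set ℂ :=
  f '' {z | deriv f z = 0}

/-- The finite asymptotic values of `f`: limits of `f` along paths `γ : [0, 1) → ℂ` going to `∞`. -/
def asymptoticValues (f : ℂ → ℂ) : Set ℂ :=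
  {a | ∃ γ : ℝ → ℂ, ContinuousOn γ (Set.Ico 0 1) ∧
    Tendsto γ (𝓝[<] 1) (Bornology.cobounded ℂ) ∧ Tendsto (fun t => f (γ t)) (𝓝[<] 1) (𝓝 a)}

/-- The set `SV(f)` of finite singular values. -/
def singularValues (f : ℂ → ℂ) : Set ℂ :=
  closure (criticalValues f ∪ asymptoticValues f)

/-- The class `𝓑`: transcendental entire functions of bounded type. -/
def IsBoundedType (f : ℂ → ℂ) : Prop :=
  IsTranscendentalEntire f ∧ Bornology.IsBounded (singularValues f)

/-- The cylindrical area `I₁(ρ, D) = (1 / 2π) ∬ dx dy / |z|²` over the points `z` with `ρ ≤ |z|` and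
`f z` in the closed disk of radius `ρ` about `0` but outside `D`; the value `∞` is allowed. -/
noncomputable def cylindricalArea (f : ℂ → ℂ) (D : Set ℂ) (ρ : ℝ) : ℝ≥0∞ :=
  ENNReal.ofReal (1 / (2 * Real.pi)) *
    ∫⁻ z in {z : ℂ | ρ ≤ ‖z‖} ∩ f ⁻¹' (Metric.closedBall 0 ρ \ D),
      ENNReal.ofReal (1 / ‖z‖ ^ 2)

/-- `f` has the asymptotic area property relative to `D`. -/
def HasAAPRelativeTo (f : ℂ → ℂ) (D : Set ℂ) : Prop :=
  limsup (fun ρ : ℝ => cylindricalArea f D ρ) atTop < ∞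

/-- `f` is of class `𝓑` and has the asymptotic area property. -/
def HasAAP (f : ℂ → ℂ) : Prop :=
  IsBoundedType f ∧
    ∀ D : Set ℂ, IsOpen D → singularValues f ⊆ D → HasAAPRelativeTo f D

/-- `χ : (0, ∞) → (0, ∞)` is a degeneration function for `f`; only the values of `χ` at positive
numbers matter. -/
def IsDegenerationFunction (f : ℂ → ℂ) (χ : ℝ → ℝ) : Prop :=
  HasAAP f ∧ (∀ ρ, 0 < ρ → 0 < χ ρ) ∧
    ∀ D : Set ℂ, IsOpen D → singularValues f ⊆ D →
      limsup (fun ρ : ℝ => cylindricalArea f D ρ / ENNReal.ofReal (χ ρ)) atTop < ∞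

end StructFinite

/-! Here `f' = p e^q`. Near infinity `f ≈ b + G`, where `G = (p / q') e^q` is `mainTerm` and `b` is
bounded. Let `a z^d` be the leading monomial of `q`. Where `|Re (a z^d)| > |z|^(d - κ)`, this real
part dominates the remaining `O(|z|^(d - 1))` of `q`, because `κ < 1`, and the exponential
overwhelms every rational factor. If the real part is negative, `G` is small and `f z` is close to
an asymptotic value `b`, hence in `D`; if it is positive, `|f z| > |z| ≥ ρ`. So for large `ρ` the
region of integration lies in the strips `|Re (a z^d)| ≤ |z|^(d - κ)`. On the circle of radius `r`
they occupy an angle `O(r^(-κ))`, and their logarithmic area beyond `ρ` is at most a constant times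
`∫_ρ^∞ r^(-κ-1) dr = ρ^(-κ) / κ`.

The expansion (`exists_expansion`) comes from moving away from `z` along a line on which `Re q`
decreases at a definite rate: `(f - G)' = -λ G`, where `λ`, the logarithmic derivative of `p / q'`,
tends to `0`, and `G` decays exponentially along the line. In the valleys of `Re q` and slightly
beyond them the line is a ray to infinity and `b` is the limit of `f` on it; elsewhere it is a
segment towards the origin that ends where `f` is bounded, and `b = 0`.

Closeness to asymptotic values gives membership in `D` uniformly only if the singular set is
compact, so the asymptotic values must be bounded (`isBounded_asymptoticValues`). A path on which
`f` tends to a large `A` eventually stays in the strips. There `|Im q| → ∞`, so `e^q` turns through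
every direction while a fixed power of the direction of `p / q'` converges; yet `G / A` has to stay
near `1`, which is impossible. -/

namespace Polynomial

/-! ### Polynomials near infinity -/

/-- A complex polynomial of degree at most `n`, divided by `z ^ n`, tends at infinity to its
`n`-th coefficient. -/
theorem tendsto_eval_div_pow_cobounded {P : ℂ[X]} {n : ℕ} (hP : P.natDegree ≤ n) :
    Tendsto (fun z => P.eval z / z ^ n) (Bornology.cobounded ℂ) (𝓝 (P.coeff n)) := by
  have h1 : Tendsto (fun z : ℂ => ∑ i ∈ Finset.range (n + 1), P.coeff i * z⁻¹ ^ (n - i))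
      (Bornology.cobounded ℂ)
      (𝓝 (∑ i ∈ Finset.range (n + 1), P.coeff i * (0 : ℂ) ^ (n - i))) :=
    tendsto_finsetSum _ fun i _ => (tendsto_inv₀_cobounded.pow _).const_mul _
  have h2 : ∑ i ∈ Finset.range (n + 1), P.coeff i * (0 : ℂ) ^ (n - i) = P.coeff n := by
    rw [Finset.sum_range_succ, Finset.sum_eq_zero]
    · simp
    · intro i hi
      rw [Finset.mem_range] at hi
      rw [zero_pow (by omega), mul_zero]
  rw [h2] at h1
  refine h1.congr' ?_
  filter_upwards [Bornology.eventually_ne_cobounded 0] with z hz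
  rw [eval_eq_sum_range' (Nat.lt_succ_of_le hP), Finset.sum_div]
  refine Finset.sum_congr rfl fun i hi => ?_
  rw [Finset.mem_range] at hi
  rw [inv_pow, mul_div_assoc]
  congr 1
  rw [inv_eq_one_div, div_eq_div_iff (pow_ne_zero _ hz) (pow_ne_zero _ hz), one_mul, ← pow_add]
  congr 1
  omega

theorem eventually_eval_ne_zero_cobounded {P : ℂ[X]} (hP : P ≠ 0) :
    ∀ᶠ z in Bornology.cobounded ℂ, P.eval z ≠ 0 := by
  filter_upwards [(tendsto_eval_div_pow_cobounded (P := P) le_rfl).eventually_ne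
    (leadingCoeff_ne_zero.2 hP)] with z hz h
  simp [h] at hz

theorem eventually_norm_eval_le_cobounded {P : ℂ[X]} {n : ℕ} (hP : P.natDegree ≤ n) :
    ∃ C > 0, ∀ᶠ z in Bornology.cobounded ℂ, ‖P.eval z‖ ≤ C * ‖z‖ ^ n := by
  refine ⟨‖P.coeff n‖ + 1, by positivity, ?_⟩
  filter_upwards [(tendsto_eval_div_pow_cobounded hP).norm.eventually_le_const (lt_add_one _),
    Bornology.eventually_ne_cobounded 0] with z hz h0
  rwa [norm_div, norm_pow, div_le_iff₀ (by positivity)] at hz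

theorem eventually_le_norm_eval_cobounded {P : ℂ[X]} (hP : P ≠ 0) :
    ∃ C > 0, ∀ᶠ z in Bornology.cobounded ℂ, C * ‖z‖ ^ P.natDegree ≤ ‖P.eval z‖ := by
  have h0 : 0 < ‖P.leadingCoeff‖ := norm_pos_iff.2 (leadingCoeff_ne_zero.2 hP)
  refine ⟨‖P.leadingCoeff‖ / 2, by positivity, ?_⟩
  filter_upwards [(tendsto_eval_div_pow_cobounded (P := P) le_rfl).norm.eventually_const_le
    (half_lt_self h0), Bornology.eventually_ne_cobounded 0] with z hz h0
  rwa [norm_div, norm_pow, le_div_iff₀ (by positivity)] at hz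

/-- The logarithmic derivative of a nonzero polynomial tends to zero at infinity. -/
theorem tendsto_derivative_div_cobounded {P : ℂ[X]} (hP : P ≠ 0) :
    Tendsto (fun z => P.derivative.eval z / P.eval z) (Bornology.cobounded ℂ) (𝓝 0) := by
  have h1 : (X * P.derivative).natDegree ≤ P.natDegree := by
    rcases Nat.eq_zero_or_pos P.natDegree with h | h
    · rw [natDegree_eq_zero_iff_degree_le_zero, degree_le_zero_iff] at h
      rw [h]
      simp
    · refine natDegree_mul_le.trans ?_
      have := natDegree_derivative_lt h.ne'
      rw [natDegree_X]
      omega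
  have h2 := (tendsto_inv₀_cobounded (α := ℂ)).mul ((tendsto_eval_div_pow_cobounded h1).div
    (tendsto_eval_div_pow_cobounded (P := P) le_rfl) (leadingCoeff_ne_zero.2 hP))
  rw [zero_mul] at h2
  refine h2.congr' ?_
  filter_upwards [Bornology.eventually_ne_cobounded 0, eventually_eval_ne_zero_cobounded hP] with
    z hz hz'
  simp only [Pi.div_apply, eval_mul, eval_X]
  rw [div_div_div_cancel_right₀ (pow_ne_zero _ hz), mul_div_assoc, inv_mul_cancel_left₀ hz]

end Polynomial

/-! ### The primitive of `p e^q` and its main term -/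

namespace StructFinite

/-- The derivative of the entire function `∫₀ᶻ p e^q` is `p e^q`. -/
theorem hasDerivAt_primitiveFn (C : ℂ) (p q : ℂ[X]) (z : ℂ) :
    HasDerivAt (primitiveFn C p q) (p.eval z * Complex.exp (q.eval z)) z := by
  have hd : Differentiable ℂ fun w => p.eval w * Complex.exp (q.eval w) := by fun_prop
  -- An entire integrand has a global primitive `g`, and the integral along the segment is `g w - g
  -- 0`.
  obtain ⟨g, hg⟩ := hd.isExactOn_univ
  have key : primitiveFn C p q = fun w => C + (g w - g 0) := by
    funext w
    have h1 : ∀ t ∈ Set.uIcc (0 : ℝ) 1, HasDerivAt (fun t : ℝ => g ((t : ℂ) * w))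
        (p.eval ((t : ℂ) * w) * Complex.exp (q.eval ((t : ℂ) * w)) * w) t := by
      intro t _
      have h2 : HasDerivAt (fun t : ℝ => (t : ℂ) * w) w t := by
        simpa using (Complex.ofRealCLM.hasDerivAt (x := t)).mul_const w
      exact (hg _ (Set.mem_univ _)).comp t h2
    have h3 := intervalIntegral.integral_eq_sub_of_hasDerivAt h1
      (Continuous.intervalIntegrable (by fun_prop) _ _)
    rw [primitiveFn, h3]
    simp
  rw [key]
  exact ((hg z (Set.mem_univ _)).sub_const (g 0)).const_add C

/-- The main term `p / q' * e^q` in the expansion of `∫ p e^q` near infinity. -/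
noncomputable def mainTerm (p q : ℂ[X]) (z : ℂ) : ℂ :=
  p.eval z / q.derivative.eval z * Complex.exp (q.eval z)

/-- The logarithmic derivative of `p / q'`. -/
noncomputable def logDerivCoeff (p q : ℂ[X]) (z : ℂ) : ℂ :=
  p.derivative.eval z / p.eval z - q.derivative.derivative.eval z / q.derivative.eval z

/-- Since also `f' = q' G` for the main term `G`, this gives `(f - G)' = -λ G` with `λ` the
coefficient `logDerivCoeff`, the identity behind every estimate of `f - G`. -/
theorem hasDerivAt_mainTerm {p q : ℂ[X]} {z : ℂ} (hp : p.eval z ≠ 0)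
    (hq : q.derivative.eval z ≠ 0) :
    HasDerivAt (mainTerm p q)
      ((logDerivCoeff p q z + q.derivative.eval z) * mainTerm p q z) z := by
  have h := ((p.hasDerivAt z).fun_div (q.derivative.hasDerivAt z) hq).mul (q.hasDerivAt z).cexp
  refine h.congr_deriv ?_
  rw [mainTerm, logDerivCoeff]
  field_simp

theorem derivative_ne_zero_of_natDegree_pos {q : ℂ[X]} (hq : 0 < q.natDegree) :
    q.derivative ≠ 0 := fun h =>
  hq.ne' (Polynomial.derivative_eq_zero.1 h)

theorem tendsto_logDerivCoeff {p q : ℂ[X]} (hp : p ≠ 0) (hq : 0 < q.natDegree) :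
    Tendsto (logDerivCoeff p q) (Bornology.cobounded ℂ) (𝓝 0) := by
  have h := (Polynomial.tendsto_derivative_div_cobounded hp).sub
    (Polynomial.tendsto_derivative_div_cobounded (derivative_ne_zero_of_natDegree_pos hq))
  rwa [sub_zero] at h

section

variable {f : ℂ → ℂ} {p q : ℂ[X]}

/-- A primitive of `p e^q` is not a polynomial when `p ≠ 0` and `q` is not constant. -/
theorem isTranscendentalEntire_of_hasDerivAt (hp : p ≠ 0) (hq : 0 < q.natDegree)
    (hf : ∀ z, HasDerivAt f (p.eval z * Complex.exp (q.eval z)) z) :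
    IsTranscendentalEntire f := by
  refine ⟨fun z => (hf z).differentiableAt, ?_⟩
  rintro ⟨P, hP⟩
  obtain rfl : f = fun z => P.eval z := funext hP
  have h1 : ∀ z, P.derivative.eval z = p.eval z * Complex.exp (q.eval z) := fun z =>
    (P.hasDerivAt z).unique (hf z)
  have h2 : ∀ z, P.derivative.derivative.eval z =
      (p.derivative.eval z + p.eval z * q.derivative.eval z) * Complex.exp (q.eval z) := by
    intro z
    have h := (P.derivative.hasDerivAt z).congr_of_eventuallyEq
      (Eventually.of_forall fun w => (h1 w).symm)
    rw [h.unique ((p.hasDerivAt z).fun_mul (q.hasDerivAt z).cexp)]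
    ring
  have hP0 : P.derivative ≠ 0 := by
    intro h
    obtain ⟨z, hz⟩ := (Polynomial.eventually_eval_ne_zero_cobounded hp).exists
    have := h1 z
    rw [h, Polynomial.eval_zero, zero_eq_mul] at this
    exact this.elim hz (Complex.exp_ne_zero _)
  -- If `P' = p e^q`, then `q' = P''/P' - p'/p`, a difference of logarithmic derivatives of
  -- polynomials, which vanishes at infinity; but `q'` is a nonzero polynomial.
  have h3 : Tendsto (fun z => q.derivative.eval z) (Bornology.cobounded ℂ) (𝓝 0) := by
    have h := (Polynomial.tendsto_derivative_div_cobounded hP0).sub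
      (Polynomial.tendsto_derivative_div_cobounded hp)
    rw [sub_zero] at h
    refine h.congr' ?_
    filter_upwards [Polynomial.eventually_eval_ne_zero_cobounded hp] with z hz
    rw [h1, h2]
    have := Complex.exp_ne_zero (q.eval z)
    field_simp
    ring
  have hq' := derivative_ne_zero_of_natDegree_pos hq
  obtain ⟨c, hc, h4⟩ := Polynomial.eventually_le_norm_eval_cobounded hq'
  have h5 := h3.norm.eventually_lt_const (norm_zero.trans_lt hc)
  have h6 := (tendsto_norm_cobounded_atTop (E := ℂ)).eventually_ge_atTop 1
  obtain ⟨z, ⟨h4, h5⟩, h6⟩ := ((h4.and h5).and h6).exists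
  have := one_le_pow₀ h6 (n := q.derivative.natDegree)
  nlinarith

theorem finite_criticalValues (hp : p ≠ 0)
    (hf : ∀ z, HasDerivAt f (p.eval z * Complex.exp (q.eval z)) z) :
    (criticalValues f).Finite := by
  refine Set.Finite.image f ((p.roots.toFinset.finite_toSet).subset ?_)
  intro z hz
  rw [Set.mem_ofPred_eq, (hf z).deriv, mul_eq_zero] at hz
  simpa [hp] using hz.resolve_right (Complex.exp_ne_zero _)

/-- Along a segment on which `re q` decreases at a definite rate, `f` differs from its main
term by nearly a constant. -/
theorem norm_sub_sub_mainTerm_le_of_descent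
    (hf : ∀ z, HasDerivAt f (p.eval z * Complex.exp (q.eval z)) z)
    {z v : ℂ} {T c ε : ℝ} (hT : 0 ≤ T) (hc : 0 < c) (hεc : ε ≤ c / 2)
    (hv : ‖v‖ = 1)
    (h : ∀ s ∈ Set.Icc 0 T, p.eval (z + s * v) ≠ 0 ∧ q.derivative.eval (z + s * v) ≠ 0 ∧
      ‖logDerivCoeff p q (z + s * v)‖ ≤ ε ∧ (q.derivative.eval (z + s * v) * v).re ≤ -c) :
    ‖mainTerm p q (z + T * v)‖ ≤ ‖mainTerm p q z‖ * Real.exp (-(c / 2) * T) ∧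
      ‖f (z + T * v) - f z - (mainTerm p q (z + T * v) - mainTerm p q z)‖ ≤
        2 * ε / c * ‖mainTerm p q z‖ := by
  have hε : 0 ≤ ε := (norm_nonneg _).trans (h 0 ⟨le_rfl, hT⟩).2.2.1
  set G : ℝ → ℂ := fun s => mainTerm p q (z + s * v) with hG
  have hline : ∀ s : ℝ, HasDerivAt (fun s : ℝ => z + s * v) v s := fun s => by
    simpa using ((Complex.ofRealCLM.hasDerivAt (x := s)).mul_const v).const_add z
  have hGd : ∀ s ∈ Set.Icc 0 T, HasDerivAt G
      ((logDerivCoeff p q (z + s * v) + q.derivative.eval (z + s * v)) * G s * v) s :=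
    fun s hs => HasDerivAt.comp (h₂ := mainTerm p q) s
      (hasDerivAt_mainTerm (h s hs).1 (h s hs).2.1) (hline s)
  have hFd : ∀ s ∈ Set.Icc 0 T, HasDerivAt (fun s : ℝ => f (z + s * v))
      (q.derivative.eval (z + s * v) * G s * v) s := by
    intro s hs
    refine ((hf (z + s * v)).comp s (hline s)).congr_deriv ?_
    have := (h s hs).2.1
    simp only [hG, mainTerm]
    field_simp
  have hdecay : ∀ s ∈ Set.Icc 0 T, ‖G s‖ ≤ ‖G 0‖ * Real.exp (-(c / 2) * s) := by
    have hexp : ∀ s : ℝ, HasDerivAt (fun s : ℝ => Real.exp (c * s)) (Real.exp (c * s) * c) s :=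
      fun s => by simpa using ((hasDerivAt_id s).const_mul c).exp
    -- The logarithmic derivative of `‖G‖² e^(cs)` is `2 Re ((λ + q') v) + c ≤ 2 (c/2 - c) + c = 0`.
    have hanti : AntitoneOn (fun s => ‖G s‖ ^ 2 * Real.exp (c * s)) (Set.Icc 0 T) := by
      have hd : ∀ s ∈ Set.Icc 0 T, HasDerivAt (fun s => ‖G s‖ ^ 2 * Real.exp (c * s)) _ s :=
        fun s hs => (hGd s hs).norm_sq.mul (hexp s)
      refine antitoneOn_of_deriv_nonpos (convex_Icc 0 T)
        (fun s hs => (hd s hs).continuousAt.continuousWithinAt)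
        (fun s hs => (hd s (interior_subset hs)).differentiableAt.differentiableWithinAt) ?_
      intro s hs
      replace hs := interior_subset hs
      rw [(hd s hs).deriv]
      obtain ⟨-, -, h3, h4⟩ := h s hs
      have h5 : inner ℝ (G s)
          ((logDerivCoeff p q (z + s * v) + q.derivative.eval (z + s * v)) * G s * v) =
          ‖G s‖ ^ 2 * ((logDerivCoeff p q (z + s * v) * v).re +
            (q.derivative.eval (z + s * v) * v).re) := by
        rw [Complex.inner, ← Complex.add_re, ← Complex.re_ofReal_mul]
        congr 1
        push_cast
        rw [← Complex.mul_conj']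
        ring
      have h6 : (logDerivCoeff p q (z + s * v) * v).re ≤ c / 2 := by
        refine (Complex.re_le_norm _).trans ?_
        rw [norm_mul, hv, mul_one]
        exact h3.trans hεc
      rw [h5]
      have h7 : ‖G s‖ ^ 2 * ((logDerivCoeff p q (z + s * v) * v).re +
            (q.derivative.eval (z + s * v) * v).re) ≤ ‖G s‖ ^ 2 * (-(c / 2)) :=
        mul_le_mul_of_nonneg_left (by linarith) (by positivity)
      have h8 := Real.exp_pos (c * s)
      nlinarith
    intro s hs
    have h1 := hanti ⟨le_rfl, hT⟩ hs hs.1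
    simp only [mul_zero, Real.exp_zero, mul_one] at h1
    refine le_of_sq_le_sq ?_ (by positivity)
    rw [mul_pow, ← Real.exp_nat_mul]
    have h2 : ((2 : ℕ) : ℝ) * (-(c / 2) * s) = -(c * s) := by push_cast; ring
    rw [h2, Real.exp_neg, ← div_eq_mul_inv, le_div_iff₀ (Real.exp_pos _)]
    exact h1
  have hG0 : G 0 = mainTerm p q z := by simp [hG]
  rw [← hG0]
  refine ⟨hdecay T ⟨hT, le_rfl⟩, ?_⟩
  -- The boundary function is the integral of `ε ‖G 0‖ e^(-cs/2)` from `0`; its total mass is `2 ε /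
  -- c * ‖G 0‖`, whatever the length `T`.
  have hB : ∀ s : ℝ, HasDerivAt
      (fun s : ℝ => 2 * ε / c * ‖G 0‖ * (1 - Real.exp (-(c / 2) * s)))
      (ε * (‖G 0‖ * Real.exp (-(c / 2) * s))) s := by
    intro s
    refine (((((hasDerivAt_id s).const_mul (-(c / 2))).exp).const_sub 1).const_mul
      (2 * ε / c * ‖G 0‖)).congr_deriv ?_
    simp only [id]
    field_simp
  have hE : ∀ s ∈ Set.Icc 0 T, HasDerivAt
      (fun s : ℝ => f (z + s * v) - f z - (G s - G 0))
      (-(logDerivCoeff p q (z + s * v) * G s * v)) s := by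
    intro s hs
    refine (((hFd s hs).sub_const (f z)).sub ((hGd s hs).sub_const (G 0))).congr_deriv ?_
    ring
  have hmain := image_norm_le_of_norm_deriv_right_le_deriv_boundary (a := 0) (b := T)
    (fun s hs => (hE s hs).continuousAt.continuousWithinAt)
    (fun s hs => (hE s (Set.Ico_subset_Icc_self hs)).hasDerivWithinAt)
    (by simp) hB (fun s hs => by
      have hs' := Set.Ico_subset_Icc_self hs
      rw [norm_neg, norm_mul, norm_mul, hv, mul_one]
      exact mul_le_mul (h s hs').2.2.1 (hdecay s hs') (norm_nonneg _) hε)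
    (Set.right_mem_Icc.2 hT)
  refine hmain.trans (mul_le_of_le_one_right (by positivity) ?_)
  linarith [Real.exp_pos (-(c / 2) * T)]

end

end StructFinite

/-! ### Arguments and norms along horizontal rays -/

namespace Complex

/-- A shift to the right can only increase `re / ‖·‖`, the cosine of the argument, and cosine is
decreasing on `[0, π]`. Rays therefore do not leave a sector about the positive axis. -/
theorem abs_arg_add_ofReal_le {ζ : ℂ} {s : ℝ} (hζ : ζ ≠ 0) (hs : 0 ≤ s) (h : ζ + s ≠ 0) :
    |arg (ζ + s)| ≤ |arg ζ| := by
  have hmem : ∀ x : ℂ, |arg x| ∈ Set.Icc 0 Real.pi := fun x => ⟨abs_nonneg _, abs_arg_le_pi x⟩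
  rw [← Real.strictAntiOn_cos.le_iff_ge (hmem _) (hmem _), Real.cos_abs, Real.cos_abs,
    cos_arg hζ, cos_arg h, div_le_div_iff₀ (norm_pos_iff.2 hζ) (norm_pos_iff.2 h), add_re,
    ofReal_re]
  have h1 : ‖ζ + s‖ ≤ ‖ζ‖ + s := (norm_add_le _ _).trans_eq (by
    rw [norm_real, Real.norm_of_nonneg hs])
  have h2 : ‖ζ‖ - s ≤ ‖ζ + s‖ := by
    have := norm_sub_norm_le ζ (-(s : ℂ))
    rwa [norm_neg, norm_real, Real.norm_of_nonneg hs, sub_neg_eq_add] at this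
  have h3 := abs_le.1 (abs_re_le_norm ζ)
  rcases le_total 0 ζ.re with h0 | h0 <;> nlinarith

/-- The cosine of the argument is at least `-√2/2`, so completing the square in `s` bounds `‖ζ +
s‖²` below by `‖ζ‖² / 2`. Thus a ray that starts far out stays far out. -/
theorem half_norm_le_norm_add_ofReal {ζ : ℂ} {s : ℝ} (hs : 0 ≤ s)
    (h : |arg ζ| ≤ 3 * Real.pi / 4) :
    ‖ζ‖ / 2 ≤ ‖ζ + s‖ := by
  rcases eq_or_ne ζ 0 with rfl | hζ
  · simp
  have h1 : -(√2 / 2) ≤ ζ.re / ‖ζ‖ := by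
    rw [← cos_arg hζ, ← Real.cos_abs, ← Real.cos_pi_div_four, ← Real.cos_pi_sub]
    exact Real.cos_le_cos_of_nonneg_of_le_pi (abs_nonneg _) (by linarith [Real.pi_pos])
      (h.trans (by linarith))
  rw [le_div_iff₀ (norm_pos_iff.2 hζ)] at h1
  refine le_of_sq_le_sq ?_ (norm_nonneg _)
  have h3 : ‖ζ + s‖ ^ 2 = ‖ζ‖ ^ 2 + 2 * s * ζ.re + s ^ 2 := by
    rw [← normSq_eq_norm_sq, ← normSq_eq_norm_sq, normSq_apply, normSq_apply]
    simp
    ring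
  rw [h3]
  have h4 : √2 ^ 2 = 2 := Real.sq_sqrt (by norm_num)
  have h5 : 0 ≤ √2 := Real.sqrt_nonneg 2
  have h6 : 0 ≤ ‖ζ‖ := norm_nonneg _
  nlinarith [sq_nonneg (s - √2 / 2 * ‖ζ‖), mul_le_mul_of_nonneg_left h1 hs]

theorem cos_mul_norm_pow_le_re_pow {ζ : ℂ} {β : ℝ} {n : ℕ} (h : |arg ζ| ≤ β)
    (hn : n * β ≤ Real.pi) : Real.cos (n * β) * ‖ζ‖ ^ n ≤ (ζ ^ n).re := by
  have h1 : (ζ ^ n).re = ‖ζ‖ ^ n * Real.cos (n * arg ζ) := by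
    conv_lhs => rw [← norm_mul_exp_arg_mul_I ζ, mul_pow, ← exp_nat_mul, ← ofReal_pow,
      re_ofReal_mul, ← mul_assoc, ← ofReal_natCast, ← ofReal_mul, exp_ofReal_mul_I_re]
  rw [h1, mul_comm]
  refine mul_le_mul_of_nonneg_left ?_ (by positivity)
  rw [← Real.cos_abs (n * arg ζ), abs_mul, Nat.abs_cast]
  exact Real.cos_le_cos_of_nonneg_of_le_pi (by positivity) hn (by gcongr)

/-- Polar decomposition relative to the directions `u` in which `a * u ^ d` is negative. -/
theorem exists_mul_eq_and_arg_eq {a z : ℂ} {d : ℕ} (hd : 0 < d) (hz : z ≠ 0) :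
    ∃ u ζ : ℂ, z = u * ζ ∧ -(a * u ^ d) = ‖a‖ ∧ ‖u‖ = 1 ∧ ‖ζ‖ = ‖z‖ ∧
      arg ζ = arg (-(a * z ^ d)) / d := by
  set η := -(a * z ^ d) with hη
  set e := exp ((arg η / d : ℝ) * I) with he
  have hd' : (d : ℝ) ≠ 0 := by exact_mod_cast hd.ne'
  have hz' : (‖z‖ : ℂ) ≠ 0 := by exact_mod_cast norm_ne_zero_iff.2 hz
  have he0 : e ≠ 0 := exp_ne_zero _
  have he1 : ‖e‖ = 1 := norm_exp_ofReal_mul_I _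
  have hed : e ^ d = exp (arg η * I) := by
    rw [he, ← exp_nat_mul]
    congr 1
    push_cast
    have : (d : ℂ) ≠ 0 := by exact_mod_cast hd'
    field_simp
  have hu : ‖z / (‖z‖ * e)‖ = 1 := by
    rw [norm_div, norm_mul, he1, norm_real, norm_norm, mul_one, div_self (norm_ne_zero_iff.2 hz)]
  refine ⟨z / (‖z‖ * e), ‖z‖ * e, ?_, ?_, hu, ?_, ?_⟩
  · rw [div_mul_cancel₀ _ (mul_ne_zero hz' he0)]
  · have h1 : -(a * (z / (‖z‖ * e)) ^ d) = η / (‖z‖ ^ d * exp (arg η * I)) := by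
      rw [div_pow, mul_pow, hed, hη]
      ring
    rw [h1, div_eq_iff (mul_ne_zero (pow_ne_zero _ hz') (exp_ne_zero _)), ← mul_assoc,
      ← ofReal_pow, ← norm_pow, ← ofReal_mul, ← norm_mul, ← norm_neg (a * z ^ d), ← hη,
      norm_mul_exp_arg_mul_I]
  · rw [norm_mul, he1, norm_real, norm_norm, mul_one]
  · rw [arg_real_mul _ (norm_pos_iff.2 hz), he, arg_exp_mul_I, toIocMod_eq_self]
    have h1 := neg_pi_lt_arg η
    have h2 := arg_le_pi η
    have h3 : (1 : ℝ) ≤ d := by exact_mod_cast hd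
    have h4 := Real.pi_pos
    constructor
    · rw [lt_div_iff₀ (by positivity)]; nlinarith
    · rw [div_le_iff₀ (by positivity)]; nlinarith

end Complex

/-! ### Valleys and hills of the leading monomial -/

namespace StructFinite

/-- Minus the leading monomial of `q`. -/
noncomputable def negLead (q : ℂ[X]) (z : ℂ) : ℂ :=
  -(q.leadingCoeff * z ^ q.natDegree)

theorem exists_re_eval_add_le (q : ℂ[X]) :
    ∃ C > 0, ∀ᶠ z in Bornology.cobounded ℂ,
      |(q.eval z).re + (negLead q z).re| ≤ C * ‖z‖ ^ (q.natDegree - 1) := by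
  have h1 : q.eraseLead.natDegree ≤ q.natDegree - 1 := q.eraseLead_natDegree_le
  obtain ⟨C, hC, h⟩ := Polynomial.eventually_norm_eval_le_cobounded h1
  refine ⟨C, hC, h.mono fun z hz => ?_⟩
  refine le_trans ?_ hz
  have h2 : q.eval z + negLead q z = q.eraseLead.eval z := by
    have h3 := congrArg (Polynomial.eval z) q.eraseLead_add_C_mul_X_pow
    rw [← h3, Polynomial.eval_add]
    simp [negLead]
  rw [← Complex.add_re, h2]
  exact Complex.abs_re_le_norm _

/-- The filter of neighbourhoods of infinity where the leading monomial of `q` has very negative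
real part. -/
noncomputable def valleyFilter (q : ℂ[X]) (κ : ℝ) : Filter ℂ :=
  Bornology.cobounded ℂ ⊓ 𝓟 {z | ‖z‖ ^ q.natDegree * ‖z‖ ^ (-κ) ≤ (negLead q z).re}

/-- The lower terms of `q` contribute `O(‖z‖^(d-1))`, less than `‖z‖^(d-κ)` since `κ < 1`. Hence
eventually `Re q ≤ C₂ - ‖z‖^(1-κ)`, and this stretched exponential beats any power. Applied to `-q`,
it also controls the hills. -/
theorem tendsto_eval_mul_exp_valleyFilter {q : ℂ[X]} (hq : 0 < q.natDegree) {κ : ℝ} (hκ : κ < 1)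
    (P : ℂ[X]) :
    Tendsto (fun z => P.eval z * Complex.exp (q.eval z)) (valleyFilter q κ) (𝓝 0) := by
  obtain ⟨C₁, hC₁, h1⟩ := Polynomial.eventually_norm_eval_le_cobounded (P := P) le_rfl
  obtain ⟨C₂, hC₂, h2⟩ := exists_re_eval_add_le q
  have hκ' : 0 < 1 - κ := sub_pos.2 hκ
  have hn := tendsto_norm_cobounded_atTop (E := ℂ)
  have ht : Tendsto (fun z : ℂ => ‖z‖ ^ (1 - κ)) (Bornology.cobounded ℂ) atTop :=
    (tendsto_rpow_atTop hκ').comp hn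
  have hlim : Tendsto (fun z : ℂ => C₁ * Real.exp C₂ *
      ((‖z‖ ^ (1 - κ)) ^ ((P.natDegree : ℝ) / (1 - κ)) * Real.exp (-1 * ‖z‖ ^ (1 - κ))))
      (Bornology.cobounded ℂ) (𝓝 0) := by
    have := ((tendsto_rpow_mul_exp_neg_mul_atTop_nhds_zero ((P.natDegree : ℝ) / (1 - κ)) 1
      one_pos).comp ht).const_mul (C₁ * Real.exp C₂)
    rwa [mul_zero] at this
  refine squeeze_zero_norm' ?_ (hlim.mono_left inf_le_left)
  rw [valleyFilter, eventually_inf_principal]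
  filter_upwards [h1, h2, hn.eventually_ge_atTop 1, ht.eventually_ge_atTop C₂] with z h1 h2 h3 h4 h5
  have hz : 0 < ‖z‖ := one_pos.trans_le h3
  rw [norm_mul, Complex.norm_exp, ← Real.rpow_mul hz.le, mul_div_cancel₀ _ hκ'.ne',
    Real.rpow_natCast]
  have h6 : ‖z‖ ^ q.natDegree * ‖z‖ ^ (-κ) = ‖z‖ ^ (q.natDegree - 1) * ‖z‖ ^ (1 - κ) := by
    conv_lhs => rw [← Nat.sub_add_cancel hq, pow_succ, mul_assoc, ← Real.rpow_one_add' hz.le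
      (by rw [← sub_eq_add_neg]; exact hκ'.ne'), ← sub_eq_add_neg]
  have h7 : (q.eval z).re ≤ C₂ - ‖z‖ ^ (1 - κ) := by
    have h8 : 1 ≤ ‖z‖ ^ (q.natDegree - 1) := one_le_pow₀ h3
    have h9 := (abs_le.1 h2).2
    nlinarith
  calc ‖P.eval z‖ * Real.exp (q.eval z).re
      ≤ (C₁ * ‖z‖ ^ P.natDegree) * Real.exp (C₂ - ‖z‖ ^ (1 - κ)) := by gcongr
    _ = _ := by rw [sub_eq_add_neg, Real.exp_add]; ring_nf

theorem tendsto_mainTerm_valleyFilter (p : ℂ[X]) {q : ℂ[X]} (hq : 0 < q.natDegree) {κ : ℝ}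
    (hκ : κ < 1) : Tendsto (mainTerm p q) (valleyFilter q κ) (𝓝 0) := by
  obtain ⟨c, hc, h1⟩ := Polynomial.eventually_le_norm_eval_cobounded
    (derivative_ne_zero_of_natDegree_pos hq)
  have h2 := (tendsto_eval_mul_exp_valleyFilter hq hκ p).norm.const_mul c⁻¹
  rw [norm_zero, mul_zero] at h2
  refine squeeze_zero_norm' ?_ h2
  refine Filter.Eventually.filter_mono (inf_le_left : valleyFilter q κ ≤ _) ?_
  filter_upwards [h1, (tendsto_norm_cobounded_atTop (E := ℂ)).eventually_ge_atTop 1] with z h1 h3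
  have h4 : c ≤ ‖q.derivative.eval z‖ :=
    (le_mul_of_one_le_right hc.le (one_le_pow₀ h3)).trans h1
  rw [mainTerm, div_mul_eq_mul_div, norm_div, div_eq_inv_mul]
  gcongr

theorem negLead_neg (q : ℂ[X]) (z : ℂ) : negLead (-q) z = -negLead q z := by
  simp [negLead]

/-- Where the leading monomial of `q` has very positive real part, the main term grows faster
than the identity. -/
theorem tendsto_div_mainTerm_valleyFilter_neg {p q : ℂ[X]} (hp : p ≠ 0) (hq : 0 < q.natDegree)
    {κ : ℝ} (hκ : κ < 1) :
    Tendsto (fun z => z / mainTerm p q z) (valleyFilter (-q) κ) (𝓝 0) := by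
  obtain ⟨c, hc, h1⟩ := Polynomial.eventually_le_norm_eval_cobounded hp
  have h2 := (tendsto_eval_mul_exp_valleyFilter (q := -q) (by simpa using hq) hκ
    (Polynomial.X * q.derivative)).norm.const_mul c⁻¹
  rw [norm_zero, mul_zero] at h2
  refine squeeze_zero_norm' ?_ h2
  refine Filter.Eventually.filter_mono (inf_le_left : valleyFilter (-q) κ ≤ _) ?_
  filter_upwards [h1, (tendsto_norm_cobounded_atTop (E := ℂ)).eventually_ge_atTop 1] with z h1 h3
  have h4 : c ≤ ‖p.eval z‖ := (le_mul_of_one_le_right hc.le (one_le_pow₀ h3)).trans h1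
  have h5 : z / mainTerm p q z =
      (Polynomial.X * q.derivative).eval z * Complex.exp ((-q).eval z) / p.eval z := by
    simp only [mainTerm, Polynomial.eval_mul, Polynomial.eval_X, Polynomial.eval_neg,
      Complex.exp_neg]
    rw [div_mul_eq_mul_div, div_div_eq_mul_div, ← div_eq_mul_inv, div_div, mul_comm (p.eval z)]
  rw [h5, norm_div, div_eq_inv_mul]
  gcongr

/-! ### Lines of descent for `Re q`, and limits of `f` along them -/

section

variable {f : ℂ → ℂ} {p q : ℂ[X]}

theorem exists_norm_derivative_sub_le (hq : 0 < q.natDegree) {ε : ℝ} (hε : 0 < ε) :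
    ∃ R : ℝ, 1 ≤ R ∧ ∀ w : ℂ, R ≤ ‖w‖ →
      ‖q.derivative.eval w - q.natDegree * q.leadingCoeff * w ^ (q.natDegree - 1)‖ ≤
        ε * ‖w‖ ^ (q.natDegree - 1) := by
  have h1 := Polynomial.tendsto_eval_div_pow_cobounded (P := q.derivative)
    (n := q.natDegree - 1) q.natDegree_derivative_le
  have h2 : q.derivative.coeff (q.natDegree - 1) = q.natDegree * q.leadingCoeff := by
    rw [Polynomial.coeff_derivative, Nat.sub_add_cancel hq, Polynomial.leadingCoeff]
    have : ((q.natDegree - 1 : ℕ) : ℂ) + 1 = q.natDegree := by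
      exact_mod_cast Nat.sub_add_cancel hq
    rw [this, mul_comm]
  rw [h2] at h1
  have h3 := Metric.tendsto_nhds.1 h1 ε hε
  obtain ⟨R, -, hR⟩ := (hasBasis_cobounded_norm (E := ℂ)).eventually_iff.1 h3
  refine ⟨max R 1, le_max_right _ _, fun w hw => ?_⟩
  have hw0 : 0 < ‖w‖ := one_pos.trans_le ((le_max_right _ _).trans hw)
  have h4 := (hR ((le_max_left _ _).trans hw)).le
  have h5 : q.derivative.eval w - q.natDegree * q.leadingCoeff * w ^ (q.natDegree - 1) =
      (q.derivative.eval w / w ^ (q.natDegree - 1) - q.natDegree * q.leadingCoeff) *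
        w ^ (q.natDegree - 1) := by
    rw [sub_mul, div_mul_cancel₀ _ (pow_ne_zero _ (norm_pos_iff.1 hw0))]
  rw [dist_eq_norm] at h4
  rw [h5, norm_mul, norm_pow]
  gcongr

/-- From a point where the leading term of `q` has negative or only slightly positive real part,
`re q` decreases along a half-line in one of finitely many directions. -/
theorem exists_descending_ray (hq : 0 < q.natDegree) :
    ∃ c > 0, ∃ R > 0, ∀ z, R ≤ ‖z‖ →
      |Complex.arg (negLead q z)| ≤ Real.pi / 2 + Real.pi / (4 * q.natDegree) →
      ∃ u, negLead q u = ‖q.leadingCoeff‖ ∧ ‖u‖ = 1 ∧ ∀ s : ℝ, 0 ≤ s →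
        ‖z‖ / 2 ≤ ‖z + s * u‖ ∧ (q.derivative.eval (z + s * u) * u).re ≤ -c := by
  set d := q.natDegree with hd
  have hd1 : (1 : ℝ) ≤ d := by exact_mod_cast hq
  have hπ := Real.pi_pos
  set β := (Real.pi / 2 + Real.pi / (4 * d)) / d with hβ
  have hβ0 : 0 ≤ β := by positivity
  have hβ1 : β ≤ 3 * Real.pi / 4 := by
    have h1 : Real.pi / (4 * d) ≤ Real.pi / 4 :=
      div_le_div_of_nonneg_left hπ.le (by norm_num) (by linarith)
    have h2 : β ≤ Real.pi / 2 + Real.pi / (4 * d) := div_le_self (by positivity) hd1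
    linarith
  -- With `z = u ζ`, the derivative of `q` in direction `u` is to leading order `-d ‖a‖ ζ^(d-1)`, so
  -- descent needs `(d-1) |arg ζ| < π/2`. The slack `π / (4d)` past the valley is small enough for
  -- this.
  have hβ2 : ((d - 1 : ℕ) : ℝ) * β < Real.pi / 2 := by
    rw [Nat.cast_sub hq, Nat.cast_one, hβ, ← mul_div_assoc, div_lt_iff₀ (by linarith)]
    have h1 : Real.pi / (4 * d) * d = Real.pi / 4 := by field_simp
    have h2 : 0 < Real.pi / (4 * d) := by positivity
    nlinarith
  set c₁ := Real.cos (((d - 1 : ℕ) : ℝ) * β) with hc₁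
  have hc₁0 : 0 < c₁ :=
    Real.cos_pos_of_mem_Ioo ⟨by have : 0 ≤ ((d - 1 : ℕ) : ℝ) * β := by positivity
                                linarith, hβ2⟩
  have ha : 0 < ‖q.leadingCoeff‖ :=
    norm_pos_iff.2 (Polynomial.leadingCoeff_ne_zero.2 (Polynomial.ne_zero_of_natDegree_gt hq))
  -- Half of the decrease from the leading monomial; the other half absorbs the error in replacing
  -- `q'` by its leading term.
  set c := d * ‖q.leadingCoeff‖ * c₁ / 2 with hc
  have hc0 : 0 < c := by positivity
  obtain ⟨R, hR1, hR⟩ := exists_norm_derivative_sub_le hq hc0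
  refine ⟨c, hc0, 2 * R, by linarith, fun z hz harg => ?_⟩
  have hz0 : 0 < ‖z‖ := by linarith
  obtain ⟨u, ζ, hzu, hu, hu1, hζn, hζ⟩ :=
    Complex.exists_mul_eq_and_arg_eq (a := q.leadingCoeff) hq (norm_pos_iff.1 hz0)
  have hζβ : |Complex.arg ζ| ≤ β := by
    rw [hζ, abs_div, Nat.abs_cast, hβ]
    gcongr
    exact harg
  have hζ0 : ζ ≠ 0 := by rw [← norm_pos_iff, hζn]; exact hz0
  refine ⟨u, hu, hu1, fun s hs => ?_⟩
  have hw : z + s * u = u * (ζ + s) := by rw [hzu]; ring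
  have hwn : ‖z + s * u‖ = ‖ζ + s‖ := by rw [hw, norm_mul, hu1, one_mul]
  have hhalf : ‖z‖ / 2 ≤ ‖z + s * u‖ := by
    rw [hwn, ← hζn]
    exact Complex.half_norm_le_norm_add_ofReal hs (hζβ.trans hβ1)
  refine ⟨hhalf, ?_⟩
  set w := z + s * u with hwdef
  have hwR : R ≤ ‖w‖ := by linarith
  have hw1 : 1 ≤ ‖w‖ := hR1.trans hwR
  have hζs : ζ + s ≠ 0 := by rw [← norm_pos_iff, ← hwn]; linarith
  have h1 : q.natDegree * q.leadingCoeff * w ^ (d - 1) * u =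
      ((-(d * ‖q.leadingCoeff‖) : ℝ) : ℂ) * (ζ + s) ^ (d - 1) := by
    have h2 : u ^ d = u ^ (d - 1) * u := by rw [← pow_succ, Nat.sub_add_cancel hq]
    rw [hw, mul_pow]
    push_cast
    rw [← hu, ← hd, h2]
    ring
  have h2 := Complex.cos_mul_norm_pow_le_re_pow
    ((Complex.abs_arg_add_ofReal_le hζ0 hs hζs).trans hζβ) (n := d - 1) (by linarith)
  rw [← hc₁, ← hwn] at h2
  have h3 := (Complex.re_le_norm ((q.derivative.eval w -
    q.natDegree * q.leadingCoeff * w ^ (d - 1)) * u))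
  rw [norm_mul, hu1, mul_one, sub_mul, h1, Complex.sub_re, Complex.re_ofReal_mul] at h3
  have h4 := hR w hwR
  have h5 : 1 ≤ ‖w‖ ^ (d - 1) := one_le_pow₀ hw1
  have h6 : d * ‖q.leadingCoeff‖ * (c₁ * ‖w‖ ^ (d - 1)) ≤
      d * ‖q.leadingCoeff‖ * ((ζ + s) ^ (d - 1)).re :=
    mul_le_mul_of_nonneg_left h2 (by positivity)
  have h7 : d * ‖q.leadingCoeff‖ * (c₁ * ‖w‖ ^ (d - 1)) = 2 * (c * ‖w‖ ^ (d - 1)) := by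
    rw [hc]; ring
  nlinarith

theorem re_le_neg_sin_mul_norm {η : ℂ} {δ : ℝ} (hδ0 : 0 ≤ δ)
    (h : Real.pi / 2 + δ ≤ |Complex.arg η|) : η.re ≤ -(Real.sin δ * ‖η‖) := by
  have h1 : η.re = ‖η‖ * Real.cos |Complex.arg η| := by
    rw [Real.cos_abs, Complex.norm_mul_cos_arg]
  have h2 : Real.cos |Complex.arg η| ≤ -Real.sin δ := by
    rw [← Real.cos_add_pi_div_two, add_comm]
    exact Real.cos_le_cos_of_nonneg_of_le_pi (by linarith [Real.pi_pos])
      (Complex.abs_arg_le_pi η) h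
  rw [h1]
  nlinarith [norm_nonneg η]

theorem norm_negLead (q : ℂ[X]) (z : ℂ) :
    ‖negLead q z‖ = ‖q.leadingCoeff‖ * ‖z‖ ^ q.natDegree := by
  rw [negLead, norm_neg, norm_mul, norm_pow]

/-- From a point where the leading term of `q` has very positive real part, `re q` decreases along
the segment towards the origin. -/
theorem exists_descending_segment (hq : 0 < q.natDegree) :
    ∃ c > 0, ∃ R > 0, ∀ z, z ≠ 0 →
      Real.pi / 2 + Real.pi / (4 * q.natDegree) ≤ |Complex.arg (negLead q z)| →
      ∀ s : ℝ, s ≤ ‖z‖ - R →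
        ‖z + s * (-(z / ‖z‖))‖ = ‖z‖ - s ∧
          (q.derivative.eval (z + s * (-(z / ‖z‖))) * (-(z / ‖z‖))).re ≤ -c := by
  set d := q.natDegree with hd
  have hd1 : (1 : ℝ) ≤ d := by exact_mod_cast hq
  have hπ := Real.pi_pos
  have hδ : 0 < Real.sin (Real.pi / (4 * d)) := by
    refine Real.sin_pos_of_pos_of_lt_pi (by positivity) (div_lt_self hπ (by linarith))
  have ha : 0 < ‖q.leadingCoeff‖ :=
    norm_pos_iff.2 (Polynomial.leadingCoeff_ne_zero.2 (Polynomial.ne_zero_of_natDegree_gt hq))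
  set c := d * ‖q.leadingCoeff‖ * Real.sin (Real.pi / (4 * d)) / 2 with hc
  have hc0 : 0 < c := by positivity
  obtain ⟨R, hR1, hR⟩ := exists_norm_derivative_sub_le hq hc0
  refine ⟨c, hc0, R, by linarith, fun z hz harg s hs => ?_⟩
  have hz0 : 0 < ‖z‖ := norm_pos_iff.2 hz
  have hz0' : (‖z‖ : ℂ) ≠ 0 := by exact_mod_cast hz0.ne'
  set τ := (‖z‖ - s) / ‖z‖ with hτ
  have hτ0 : 0 ≤ τ := div_nonneg (by linarith) hz0.le
  have hw : z + s * (-(z / ‖z‖)) = τ * z := by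
    rw [hτ]
    push_cast
    field_simp
    ring
  have hwn : ‖(τ : ℂ) * z‖ = ‖z‖ - s := by
    rw [norm_mul, Complex.norm_real, Real.norm_of_nonneg hτ0, hτ, div_mul_cancel₀ _ hz0.ne']
  have hv1 : ‖-(z / (‖z‖ : ℂ))‖ = 1 := by
    rw [norm_neg, norm_div, Complex.norm_real, norm_norm, div_self hz0.ne']
  rw [hw]
  refine ⟨hwn, ?_⟩
  set w := (τ : ℂ) * z with hwdef
  have hwR : R ≤ ‖w‖ := by linarith
  have hw1 : 1 ≤ ‖w‖ := hR1.trans hwR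
  -- By homogeneity the radial derivative at `w = τ z` is a positive multiple of `negLead q z`, so
  -- the angle condition at `z` serves the entire segment.
  have h1 : q.natDegree * q.leadingCoeff * w ^ (d - 1) * (-(z / ‖z‖)) =
      ((d * τ ^ (d - 1) / ‖z‖ : ℝ) : ℂ) * negLead q z := by
    have h2 : z ^ d = z ^ (d - 1) * z := by rw [← pow_succ, Nat.sub_add_cancel hq]
    rw [hwdef, mul_pow, negLead, ← hd, h2]
    push_cast
    ring
  have h2 := re_le_neg_sin_mul_norm (by positivity) harg
  have h3 := (Complex.re_le_norm ((q.derivative.eval w -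
    q.natDegree * q.leadingCoeff * w ^ (d - 1)) * (-(z / ‖z‖))))
  rw [norm_mul, hv1, mul_one, sub_mul, h1, Complex.sub_re, Complex.re_ofReal_mul] at h3
  have h4 := hR w hwR
  have h5 : 1 ≤ ‖w‖ ^ (d - 1) := one_le_pow₀ hw1
  have h6 : d * τ ^ (d - 1) / ‖z‖ * (negLead q z).re ≤
      d * τ ^ (d - 1) / ‖z‖ * (-(Real.sin (Real.pi / (4 * d)) * ‖negLead q z‖)) :=
    mul_le_mul_of_nonneg_left h2 (by positivity)
  have h7 : d * τ ^ (d - 1) / ‖z‖ * (-(Real.sin (Real.pi / (4 * d)) * ‖negLead q z‖)) =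
      -(2 * (c * ‖w‖ ^ (d - 1))) := by
    have h8 : ‖w‖ = τ * ‖z‖ := by
      rw [hwdef, norm_mul, Complex.norm_real, Real.norm_of_nonneg hτ0]
    have h9 : ‖z‖ ^ d = ‖z‖ ^ (d - 1) * ‖z‖ := by rw [← pow_succ, Nat.sub_add_cancel hq]
    rw [norm_negLead, hc, h8, ← hd, h9, mul_pow]
    field_simp
  nlinarith

/-- Along a half-line on which `re q` decreases at a definite rate, `f` converges, with `f` minus its
limit comparable to the main term. -/
theorem exists_tendsto_of_descending_ray
    (hf : ∀ z, HasDerivAt f (p.eval z * Complex.exp (q.eval z)) z)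
    {z v : ℂ} {c ε : ℝ} (hc : 0 < c) (hεc : ε ≤ c / 2) (hv : ‖v‖ = 1)
    (h : ∀ s : ℝ, 0 ≤ s → p.eval (z + s * v) ≠ 0 ∧ q.derivative.eval (z + s * v) ≠ 0 ∧
      ‖logDerivCoeff p q (z + s * v)‖ ≤ ε ∧ (q.derivative.eval (z + s * v) * v).re ≤ -c) :
    ∃ b, Tendsto (fun s : ℝ => f (z + s * v)) atTop (𝓝 b) ∧
      ‖f z - b - mainTerm p q z‖ ≤ 2 * ε / c * ‖mainTerm p q z‖ := by
  have hε : 0 ≤ ε := (norm_nonneg _).trans (h 0 le_rfl).2.2.1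
  have hdesc : ∀ s T : ℝ, 0 ≤ s → 0 ≤ T →
      ‖mainTerm p q (z + (s + T : ℝ) * v)‖ ≤
        ‖mainTerm p q (z + s * v)‖ * Real.exp (-(c / 2) * T) ∧
      ‖f (z + (s + T : ℝ) * v) - f (z + s * v) -
        (mainTerm p q (z + (s + T : ℝ) * v) - mainTerm p q (z + s * v))‖ ≤
        2 * ε / c * ‖mainTerm p q (z + s * v)‖ := by
    intro s T hs hT
    have h1 := norm_sub_sub_mainTerm_le_of_descent hf (z := z + s * v) hT hc hεc hv
      (fun t ht => by
        have h2 := h (s + t) (add_nonneg hs ht.1)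
        rw [Complex.ofReal_add, add_mul, ← add_assoc] at h2
        exact h2)
    rw [add_assoc, ← add_mul, ← Complex.ofReal_add] at h1
    exact h1
  have hexp : Tendsto (fun T : ℝ => Real.exp (-(c / 2) * T)) atTop (𝓝 0) :=
    Real.tendsto_exp_atBot.comp
      (tendsto_id.const_mul_atTop_of_neg (neg_neg_of_pos (half_pos hc)))
  have hdecay : Tendsto (fun s : ℝ => mainTerm p q (z + s * v)) atTop (𝓝 0) := by
    have h1 := hexp.const_mul ‖mainTerm p q z‖
    rw [mul_zero] at h1
    refine squeeze_zero_norm' ?_ h1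
    filter_upwards [eventually_ge_atTop 0] with T hT
    simpa using (hdesc 0 T le_rfl hT).1
  have hcauchy : CauchySeq fun s : ℝ => f (z + s * v) := by
    rw [Metric.cauchySeq_iff']
    intro r hr
    -- Past `N`, `f` varies by at most `(2 ε / c + 1 + 1) ‖G‖`, with `G` taken at `N`, and `2 ε / c
    -- ≤ 1`.
    have h1 : Tendsto (fun s : ℝ => 3 * ‖mainTerm p q (z + s * v)‖) atTop (𝓝 0) := by
      simpa using hdecay.norm.const_mul 3
    obtain ⟨N, hN, hN0⟩ := ((h1.eventually_lt_const hr).and (eventually_ge_atTop 0)).exists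
    refine ⟨N, fun n hn => ?_⟩
    have h2 := hdesc N (n - N) hN0 (sub_nonneg.2 hn)
    rw [add_sub_cancel] at h2
    have h3 : Real.exp (-(c / 2) * (n - N)) ≤ 1 := by
      rw [Real.exp_le_one_iff]
      nlinarith
    have h4 : 2 * ε / c ≤ 1 := by
      rw [div_le_one hc]
      linarith
    have h5 := norm_nonneg (mainTerm p q (z + N * v))
    have h6 := norm_sub_le (mainTerm p q (z + n * v)) (mainTerm p q (z + N * v))
    have h7 := norm_add_le (f (z + n * v) - f (z + N * v) -
        (mainTerm p q (z + n * v) - mainTerm p q (z + N * v)))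
      (mainTerm p q (z + n * v) - mainTerm p q (z + N * v))
    rw [sub_add_cancel] at h7
    rw [dist_eq_norm]
    nlinarith
  obtain ⟨b, hb⟩ := cauchySeq_tendsto_of_complete hcauchy
  refine ⟨b, hb, ?_⟩
  have h1 : Tendsto (fun s : ℝ => ‖f (z + s * v) - f z -
      (mainTerm p q (z + s * v) - mainTerm p q z)‖) atTop
      (𝓝 ‖b - f z - (0 - mainTerm p q z)‖) :=
    ((hb.sub_const _).sub (hdecay.sub_const _)).norm
  have h2 : ‖f z - b - mainTerm p q z‖ = ‖b - f z - (0 - mainTerm p q z)‖ := by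
    rw [← norm_neg]
    congr 1
    ring
  rw [h2]
  refine le_of_tendsto h1 ?_
  filter_upwards [eventually_ge_atTop 0] with T hT
  simpa using (hdesc 0 T le_rfl hT).2

theorem tendsto_add_ofReal_mul_cobounded (z : ℂ) {v : ℂ} (hv : ‖v‖ = 1) :
    Tendsto (fun s : ℝ => z + s * v) atTop (Bornology.cobounded ℂ) := by
  rw [← tendsto_norm_atTop_iff_cobounded]
  refine tendsto_atTop_mono (fun s => ?_) (tendsto_atTop_add_const_right atTop (-‖z‖) tendsto_id)
  have h := norm_sub_norm_le ((s : ℂ) * v) (-z)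
  rw [norm_mul, hv, mul_one, norm_neg, Complex.norm_real, sub_neg_eq_add, add_comm _ z] at h
  exact (sub_le_sub_right (le_abs_self s) _).trans h

theorem mem_asymptoticValues_of_tendsto_ray {z v b : ℂ} (hv : ‖v‖ = 1)
    (h : Tendsto (fun s : ℝ => f (z + s * v)) atTop (𝓝 b)) : b ∈ asymptoticValues f := by
  have h1 : Tendsto (fun t : ℝ => (1 - t)⁻¹) (𝓝[<] 1) atTop := by
    refine tendsto_inv_nhdsGT_zero.comp ?_
    refine tendsto_nhdsWithin_iff.2 ⟨?_, ?_⟩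
    · have : Tendsto (fun t : ℝ => 1 - t) (𝓝 1) (𝓝 (1 - 1)) := tendsto_id.const_sub 1
      rw [sub_self] at this
      exact this.mono_left nhdsWithin_le_nhds
    · filter_upwards [self_mem_nhdsWithin] with t ht using sub_pos.2 (Set.mem_Iio.1 ht)
  refine ⟨fun t => z + ((1 - t)⁻¹ : ℝ) * v, ?_,
    (tendsto_add_ofReal_mul_cobounded z hv).comp h1, h.comp h1⟩
  have h2 : ContinuousOn (fun t : ℝ => (1 - t)⁻¹) (Set.Ico 0 1) :=
    (continuousOn_const.sub continuousOn_id).inv₀ fun t ht => (sub_pos.2 ht.2).ne'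
  exact continuousOn_const.add ((Complex.continuous_ofReal.comp_continuousOn h2).mul
    continuousOn_const)

end

/-! ### The expansion of `f` near infinity -/

section

variable {f : ℂ → ℂ} {p q : ℂ[X]}

theorem continuous_negLead (q : ℂ[X]) : Continuous (negLead q) := by
  unfold negLead
  fun_prop

theorem negLead_ofReal_mul (q : ℂ[X]) (s : ℝ) (z : ℂ) :
    negLead q (s * z) = ((s ^ q.natDegree : ℝ) : ℂ) * negLead q z := by
  simp only [negLead, mul_pow]
  push_cast
  ring

theorem eventually_mul_norm_pow_le {c κ : ℝ} (hc : 0 < c) (hκ : 0 < κ) (d : ℕ) :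
    ∀ᶠ z in Bornology.cobounded ℂ, ‖z‖ ^ d * ‖z‖ ^ (-κ) ≤ c * ‖z‖ ^ d := by
  have h := (tendsto_rpow_neg_atTop hκ).comp (tendsto_norm_cobounded_atTop (E := ℂ))
  filter_upwards [h.eventually_le_const hc] with z hz
  rw [mul_comm]
  exact mul_le_mul_of_nonneg_right hz (by positivity)

/-- On two parallel rays in a direction of fastest decrease of `re q`, the values of `f` approach
each other. -/
theorem tendsto_sub_of_parallel_rays (hq : 0 < q.natDegree)
    (hf : ∀ z, HasDerivAt f (p.eval z * Complex.exp (q.eval z)) z)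
    {u : ℂ} (hu : negLead q u = ‖q.leadingCoeff‖) (hu1 : ‖u‖ = 1) (y : ℂ) :
    Tendsto (fun s : ℝ => f (y + s * u) - f (s * u)) atTop (𝓝 0) := by
  have ha : 0 < ‖q.leadingCoeff‖ :=
    norm_pos_iff.2 (Polynomial.leadingCoeff_ne_zero.2 (Polynomial.ne_zero_of_natDegree_gt hq))
  have h1 : ∀ᶠ x in 𝓝 u, ‖q.leadingCoeff‖ / 2 * ‖x‖ ^ q.natDegree < (negLead q x).re := by
    refine ContinuousAt.eventually_lt (by fun_prop)
      (Complex.continuous_re.comp (continuous_negLead q)).continuousAt ?_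
    rw [hu, hu1, one_pow, Complex.ofReal_re]
    linarith
  obtain ⟨δ, hδ, h1⟩ := Metric.eventually_nhds_iff.1 h1
  rw [Metric.tendsto_nhds]
  intro ε hε
  have h2 := (tendsto_eval_mul_exp_valleyFilter hq (by norm_num : (1 / 2 : ℝ) < 1) p).norm
  rw [norm_zero] at h2
  have h3 := h2.eventually_lt_const (div_pos hε (by positivity : 0 < ‖y‖ + 1))
  rw [valleyFilter, eventually_inf_principal] at h3
  obtain ⟨R, -, hR⟩ := (hasBasis_cobounded_norm (E := ℂ)).eventually_iff.1 (h3.and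
    (eventually_mul_norm_pow_le (half_pos ha) (by norm_num : (0 : ℝ) < 1 / 2) q.natDegree))
  filter_upwards [eventually_gt_atTop 0, eventually_gt_atTop (‖y‖ / δ),
    eventually_ge_atTop (R + ‖y‖)] with s hs0 hsδ hsR
  rw [div_lt_iff₀ hδ] at hsδ
  have hs0' : (s : ℂ) ≠ 0 := by exact_mod_cast hs0.ne'
  -- After scaling by `1 / s` the ball shrinks to `u`, so by homogeneity all of it lies deep in the
  -- valley, where `f'` is small; the mean value inequality then compares the two rays.
  have hbound : ∀ w ∈ Metric.closedBall ((s : ℂ) * u) ‖y‖,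
      ‖p.eval w * Complex.exp (q.eval w)‖ ≤ ε / (‖y‖ + 1) := by
    intro w hw
    rw [mem_closedBall_iff_norm] at hw
    have h4 : R ≤ ‖w‖ := by
      have h5 := norm_sub_norm_le ((s : ℂ) * u) w
      rw [norm_sub_rev, norm_mul, hu1, mul_one, Complex.norm_real, Real.norm_of_nonneg hs0.le] at h5
      linarith
    obtain ⟨h5, h6⟩ := hR h4
    refine (h5 (h6.trans ?_)).le
    have h7 : w = s * (w / s) := by rw [mul_div_cancel₀ _ hs0']
    have h8 : dist (w / s) u < δ := by
      have h9 : w / s - u = (w - s * u) / s := by field_simp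
      rw [dist_eq_norm, h9, norm_div, Complex.norm_real, Real.norm_of_nonneg hs0.le,
        div_lt_iff₀ hs0]
      linarith
    have h9 := (h1 h8).le
    rw [h7, negLead_ofReal_mul, Complex.re_ofReal_mul, norm_mul, Complex.norm_real,
      Real.norm_of_nonneg hs0.le, mul_pow]
    have := mul_le_mul_of_nonneg_left h9 (pow_nonneg hs0.le q.natDegree)
    linarith
  have h4 := (convex_closedBall ((s : ℂ) * u) ‖y‖).norm_image_sub_le_of_norm_hasDerivWithin_le
    (fun w _ => (hf w).hasDerivWithinAt) hbound (Metric.mem_closedBall_self (norm_nonneg y))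
    (y := y + s * u) (by simp)
  rw [add_sub_cancel_right] at h4
  rw [dist_zero_right]
  refine h4.trans_lt ?_
  rw [div_mul_eq_mul_div, div_lt_iff₀ (by positivity)]
  nlinarith

theorem finite_setOf_negLead_eq (hq : 0 < q.natDegree) (c : ℂ) :
    {u | negLead q u = c}.Finite := by
  have h0 : -(Polynomial.C q.leadingCoeff * Polynomial.X ^ q.natDegree) - Polynomial.C c ≠ 0 := by
    intro h
    have h1 := congrArg (fun P => Polynomial.coeff P q.natDegree) h
    simp [Polynomial.coeff_C, hq.ne'] at h1
    rw [h1] at hq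
    simp at hq
  refine (Polynomial.roots _).toFinset.finite_toSet.subset
    (s := (↑(Polynomial.roots (-(Polynomial.C q.leadingCoeff * Polynomial.X ^ q.natDegree) -
      Polynomial.C c)).toFinset : Set ℂ)) fun u hu => ?_
  rw [Finset.mem_coe, Multiset.mem_toFinset, Polynomial.mem_roots h0, Polynomial.IsRoot]
  simp only [Set.mem_ofPred_eq, negLead] at hu
  simp [hu]

theorem exists_forall_norm_ge_main (hp : p ≠ 0) (hq : 0 < q.natDegree) {ε : ℝ} (hε : 0 < ε) :
    ∃ R > 0, ∀ w : ℂ, R ≤ ‖w‖ → p.eval w ≠ 0 ∧ q.derivative.eval w ≠ 0 ∧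
      ‖logDerivCoeff p q w‖ ≤ ε := by
  have h1 := (tendsto_logDerivCoeff hp hq).norm
  rw [norm_zero] at h1
  obtain ⟨R, -, hR⟩ := (hasBasis_cobounded_norm (E := ℂ)).eventually_iff.1
    ((Polynomial.eventually_eval_ne_zero_cobounded hp).and
      ((Polynomial.eventually_eval_ne_zero_cobounded
        (derivative_ne_zero_of_natDegree_pos hq)).and (h1.eventually_le_const hε)))
  exact ⟨max R 1, by positivity, fun w hw => hR ((le_max_left _ _).trans hw)⟩

/-- Expansion of `f` near infinity away from the directions where `re q` is large. -/
theorem exists_expansion_of_arg_le (hp : p ≠ 0) (hq : 0 < q.natDegree)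
    (hf : ∀ z, HasDerivAt f (p.eval z * Complex.exp (q.eval z)) z) :
    ∃ M : ℝ, 0 ≤ M ∧ ∀ ε : ℝ, 0 < ε → ∀ᶠ z in Bornology.cobounded ℂ,
      |Complex.arg (negLead q z)| ≤ Real.pi / 2 + Real.pi / (4 * q.natDegree) →
      ∃ b ∈ asymptoticValues f, ‖b‖ ≤ M ∧
        ‖f z - b - mainTerm p q z‖ ≤ ε * ‖mainTerm p q z‖ := by
  -- Parallel rays give the same limit, so every `b` is a limit along one of the finitely many rays
  -- from `0`. This makes `M` independent of `z` and `ε`.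
  obtain ⟨M, hM⟩ := ((finite_setOf_negLead_eq hq (‖q.leadingCoeff‖ : ℂ)).image
    fun u => limUnder atTop fun s : ℝ => f (s * u)).isBounded.exists_norm_le
  obtain ⟨c, hc, R₁, hR₁, hray⟩ := exists_descending_ray hq
  refine ⟨max M 0, le_max_right _ _, fun ε hε => ?_⟩
  set ε' := min (c / 2) (ε * c / 2) with hε'
  have hε'0 : 0 < ε' := by positivity
  obtain ⟨R₂, hR₂, hmain⟩ := exists_forall_norm_ge_main hp hq hε'0
  filter_upwards [(tendsto_norm_cobounded_atTop (E := ℂ)).eventually_ge_atTop R₁,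
    (tendsto_norm_cobounded_atTop (E := ℂ)).eventually_ge_atTop (2 * R₂)] with z hz1 hz2 harg
  obtain ⟨u, hu, hu1, hdesc⟩ := hray z hz1 harg
  obtain ⟨b, hb, hbz⟩ := exists_tendsto_of_descending_ray hf hc (min_le_left _ _) hu1
    (fun s hs => by
      obtain ⟨h1, h2⟩ := hdesc s hs
      obtain ⟨h3, h4, h5⟩ := hmain (z + s * u) (by linarith)
      exact ⟨h3, h4, h5, h2⟩)
  refine ⟨b, mem_asymptoticValues_of_tendsto_ray hu1 hb, ?_, hbz.trans ?_⟩
  · have h1 : Tendsto (fun s : ℝ => f (s * u)) atTop (𝓝 b) := by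
      simpa using hb.sub (tendsto_sub_of_parallel_rays hq hf hu hu1 z)
    rw [← h1.limUnder_eq]
    exact (hM _ ⟨u, hu, rfl⟩).trans (le_max_left _ _)
  · refine mul_le_mul_of_nonneg_right ?_ (norm_nonneg _)
    rw [div_le_iff₀ hc]
    linarith [min_le_right (c / 2) (ε * c / 2)]

/-- Expansion of `f` near infinity in the directions where `re q` is large. -/
theorem eventually_expansion_of_le_arg (hp : p ≠ 0) (hq : 0 < q.natDegree)
    (hf : ∀ z, HasDerivAt f (p.eval z * Complex.exp (q.eval z)) z) {ε : ℝ} (hε : 0 < ε) :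
    ∀ᶠ z in Bornology.cobounded ℂ,
      Real.pi / 2 + Real.pi / (4 * q.natDegree) ≤ |Complex.arg (negLead q z)| →
      (negLead q z).re < 0 ∧ ‖f z - mainTerm p q z‖ ≤ ε * ‖mainTerm p q z‖ := by
  have hd1 : (1 : ℝ) ≤ q.natDegree := by exact_mod_cast hq
  have hπ := Real.pi_pos
  have hδ : 0 < Real.sin (Real.pi / (4 * q.natDegree)) :=
    Real.sin_pos_of_pos_of_lt_pi (by positivity) (div_lt_self hπ (by linarith))
  have ha : 0 < ‖q.leadingCoeff‖ :=
    norm_pos_iff.2 (Polynomial.leadingCoeff_ne_zero.2 (Polynomial.ne_zero_of_natDegree_gt hq))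
  obtain ⟨c, hc, R₁, hR₁, hseg⟩ := exists_descending_segment hq
  -- Half of `ε` pays for the descent estimate; a quarter each pays for `f w` and for the main term
  -- at the endpoint `w` of the segment, both small against the main term at `z`.
  set ε' := min (c / 2) (ε / 2 * c / 2) with hε'
  have hε'0 : 0 < ε' := by positivity
  obtain ⟨R₂, hR₂, hmain⟩ := exists_forall_norm_ge_main hp hq hε'0
  set R := max R₁ R₂ with hR
  have hR0 : 0 < R := hR₁.trans_le (le_max_left _ _)
  have hfc : Continuous f := continuous_iff_continuousAt.2 fun z => (hf z).continuousAt
  obtain ⟨B, hB⟩ := ((isCompact_closedBall (0 : ℂ) R).image hfc).isBounded.exists_norm_le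
  have hn := tendsto_norm_cobounded_atTop (E := ℂ)
  have hexp : Tendsto (fun z : ℂ => Real.exp (-(c / 2) * (‖z‖ - R))) (Bornology.cobounded ℂ)
      (𝓝 0) :=
    Real.tendsto_exp_atBot.comp ((tendsto_atTop_add_const_right _ (-R) hn).const_mul_atTop_of_neg
      (neg_neg_of_pos (half_pos hc)))
  have hbig := (tendsto_div_mainTerm_valleyFilter_neg hp hq (by norm_num : (1 / 2 : ℝ) < 1)).norm
  rw [norm_zero] at hbig
  have hbig' := hbig.eventually_lt_const one_pos
  rw [valleyFilter, eventually_inf_principal] at hbig'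
  filter_upwards [hn.eventually_ge_atTop R, hn.eventually_ge_atTop (4 * B / ε),
    hexp.eventually_le_const (by positivity : 0 < ε / 4), hbig',
    eventually_mul_norm_pow_le (mul_pos hδ ha) (by norm_num : (0 : ℝ) < 1 / 2) q.natDegree]
    with z hzR hzB hzexp hzbig hzpow harg
  have hz0 : 0 < ‖z‖ := hR0.trans_le hzR
  have hre := re_le_neg_sin_mul_norm (by positivity) harg
  rw [norm_negLead, ← mul_assoc] at hre
  refine ⟨hre.trans_lt (neg_neg_of_pos (by positivity)), ?_⟩
  have hT : 0 ≤ ‖z‖ - R := sub_nonneg.2 hzR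
  have hz0' : (‖z‖ : ℂ) ≠ 0 := by exact_mod_cast hz0.ne'
  have hv1 : ‖-(z / (‖z‖ : ℂ))‖ = 1 := by
    rw [norm_neg, norm_div, Complex.norm_real, norm_norm, div_self hz0.ne']
  have hseg' := hseg z (norm_pos_iff.1 hz0) harg
  obtain ⟨h1, h2⟩ := norm_sub_sub_mainTerm_le_of_descent hf hT hc (min_le_left _ _ : ε' ≤ c / 2) hv1
    (fun s hs => by
      obtain ⟨h3, h4⟩ := hseg' s (hs.2.trans (by linarith [le_max_left R₁ R₂]))
      obtain ⟨h5, h6, h7⟩ := hmain (z + s * (-(z / ‖z‖)))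
        (by rw [h3]; linarith [hs.2, le_max_right R₁ R₂])
      exact ⟨h5, h6, h7, h4⟩)
  have hw : ‖f (z + (‖z‖ - R : ℝ) * (-(z / ‖z‖)))‖ ≤ B := by
    refine hB _ ⟨_, ?_, rfl⟩
    rw [mem_closedBall_zero_iff, (hseg' _ (by linarith [le_max_left R₁ R₂])).1]
    linarith
  set w := z + (‖z‖ - R : ℝ) * (-(z / ‖z‖)) with hwdef
  have hG : ‖z‖ ≤ ‖mainTerm p q z‖ := by
    have h3 : mainTerm p q z ≠ 0 := by
      obtain ⟨h5, h6, -⟩ := hmain z ((le_max_right _ _).trans hzR)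
      exact mul_ne_zero (div_ne_zero h5 h6) (Complex.exp_ne_zero _)
    have h4 := hzbig (by
      rw [Polynomial.natDegree_neg, negLead_neg, Complex.neg_re]
      linarith)
    rw [norm_div, div_lt_one (norm_pos_iff.2 h3)] at h4
    exact h4.le
  have h3 : 2 * ε' / c ≤ ε / 2 := by
    rw [div_le_iff₀ hc]
    linarith [min_le_right (c / 2) (ε / 2 * c / 2)]
  have h4 : B ≤ ε / 4 * ‖mainTerm p q z‖ := by
    rw [div_le_iff₀ hε] at hzB
    nlinarith
  have h5 : f z - mainTerm p q z =
      -(f w - f z - (mainTerm p q w - mainTerm p q z)) + f w - mainTerm p q w := by ring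
  have h6 := norm_sub_le (-(f w - f z - (mainTerm p q w - mainTerm p q z)) + f w) (mainTerm p q w)
  have h7 := norm_add_le (-(f w - f z - (mainTerm p q w - mainTerm p q z))) (f w)
  rw [norm_neg] at h7
  rw [h5]
  have h8 := norm_nonneg (mainTerm p q z)
  nlinarith

/-- Near infinity, `f` is approximated by its main term up to a bounded quantity `b`, which is an
asymptotic value of `f` where the leading term of `q` has negative real part. -/
theorem exists_expansion (hp : p ≠ 0) (hq : 0 < q.natDegree)
    (hf : ∀ z, HasDerivAt f (p.eval z * Complex.exp (q.eval z)) z) :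
    ∃ M : ℝ, 0 ≤ M ∧ ∀ ε : ℝ, 0 < ε → ∀ᶠ z in Bornology.cobounded ℂ, ∃ b : ℂ, ‖b‖ ≤ M ∧
      ‖f z - b - mainTerm p q z‖ ≤ ε * ‖mainTerm p q z‖ ∧
      (0 ≤ (negLead q z).re → b ∈ asymptoticValues f) := by
  obtain ⟨M, hM, h1⟩ := exists_expansion_of_arg_le hp hq hf
  refine ⟨M, hM, fun ε hε => ?_⟩
  filter_upwards [h1 ε hε, eventually_expansion_of_le_arg hp hq hf hε] with z h1 h2
  rcases le_total |Complex.arg (negLead q z)| (Real.pi / 2 + Real.pi / (4 * q.natDegree)) with h | h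
  · obtain ⟨b, hb, hbM, hbz⟩ := h1 h
    exact ⟨b, hbM, hbz, fun _ => hb⟩
  · obtain ⟨h3, h4⟩ := h2 h
    exact ⟨0, by simpa using hM, by simpa using h4, fun h5 => absurd h3 h5.not_gt⟩

end

/-! ### Boundedness of the asymptotic values -/

/-- A continuous real function on `[0, 1)` whose absolute value tends to infinity at `1` meets every
residue class modulo `2 * π` arbitrarily close to `1`. -/
theorem frequently_eq_add_two_pi_mul_of_tendsto_abs {h : ℝ → ℝ}
    (hc : ContinuousOn h (Set.Ico 0 1)) (ht : Tendsto (fun t => |h t|) (𝓝[<] 1) atTop) (θ : ℝ) :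
    ∃ᶠ t in 𝓝[<] (1 : ℝ), ∃ k : ℤ, h t = θ + 2 * Real.pi * k := by
  rw [frequently_iff]
  intro U hU
  obtain ⟨l, hl, hlU⟩ := mem_nhdsLT_iff_exists_Ioo_subset.1 hU
  rw [Set.mem_Iio] at hl
  obtain ⟨t₁, ht₁, ht₁'⟩ := exists_between (max_lt hl one_pos)
  have hπ := Real.two_pi_pos
  obtain ⟨t₂, ht₂, ht₂', ht₂''⟩ := ((ht.eventually_ge_atTop (|h t₁| + 2 * Real.pi)).and
    (Ioo_mem_nhdsLT ht₁')).exists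
  have hsub : Set.uIcc t₁ t₂ ⊆ Set.Ioo (max l 0) 1 := by
    rw [Set.uIcc_of_le ht₂'.le]
    exact fun x hx => ⟨ht₁.trans_le hx.1, hx.2.trans_lt ht₂''⟩
  have hlen : 2 * Real.pi ≤ |h t₂ - h t₁| := by
    have := abs_sub_abs_le_abs_sub (h t₂) (h t₁)
    linarith
  have hiv := intermediate_value_uIcc (hc.mono fun x hx =>
    ⟨(le_max_right l 0).trans (hsub hx).1.le, (hsub hx).2⟩ : ContinuousOn h (Set.uIcc t₁ t₂))
  obtain ⟨k, hk⟩ : ∃ k : ℤ, θ + 2 * Real.pi * k ∈ Set.uIcc (h t₁) (h t₂) := by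
    refine ⟨⌈(min (h t₁) (h t₂) - θ) / (2 * Real.pi)⌉, ?_⟩
    have h1 := Int.le_ceil ((min (h t₁) (h t₂) - θ) / (2 * Real.pi))
    have h2 := (Int.ceil_lt_add_one ((min (h t₁) (h t₂) - θ) / (2 * Real.pi))).le
    rw [div_le_iff₀ hπ] at h1
    rw [← sub_le_iff_le_add, le_div_iff₀ hπ] at h2
    rw [← max_sub_min_eq_abs] at hlen
    rw [Set.uIcc, Set.mem_Icc]
    constructor <;> nlinarith
  obtain ⟨t, htm, htk⟩ := hiv hk
  exact ⟨t, hlU ⟨(le_max_left l 0).trans_lt (hsub htm).1, (hsub htm).2⟩, k, htk⟩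

/-- The factor of modulus one in the polar decomposition of a complex number. -/
noncomputable def unitPart : ℂ →*₀ ℂ where
  toFun z := z / ‖z‖
  map_zero' := by simp
  map_one' := by simp
  map_mul' z w := by
    rw [norm_mul, Complex.ofReal_mul, mul_div_mul_comm]

theorem unitPart_apply (z : ℂ) : unitPart z = z / ‖z‖ := rfl

theorem norm_unitPart {z : ℂ} (hz : z ≠ 0) : ‖unitPart z‖ = 1 := by
  rw [unitPart_apply, norm_div, Complex.norm_real, norm_norm, div_self (norm_ne_zero_iff.2 hz)]

theorem unitPart_exp (z : ℂ) : unitPart (Complex.exp z) = Complex.exp (z.im * Complex.I) := by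
  rw [unitPart_apply, Complex.norm_exp, Complex.ofReal_exp, ← Complex.exp_sub]
  congr 1
  rw [sub_eq_iff_eq_add', Complex.re_add_im]

theorem continuousAt_unitPart {z : ℂ} (hz : z ≠ 0) : ContinuousAt unitPart z := by
  have h : ContinuousAt (fun z : ℂ => z / ‖z‖) z :=
    ContinuousAt.div₀ (by fun_prop) (by fun_prop) (by simpa using hz)
  exact h

/-- This is `z² = 2 (Re z) z - |z|²`, normalised. If `Re z / ‖z‖ → 0`, the squared direction tends
to `-1`. -/
theorem unitPart_sq {z : ℂ} (hz : z ≠ 0) :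
    unitPart z ^ 2 = 2 * (z.re / ‖z‖ : ℝ) * unitPart z - 1 := by
  have h1 : (‖z‖ : ℂ) ≠ 0 := by exact_mod_cast norm_ne_zero_iff.2 hz
  have h2 := Complex.mul_conj' z
  have h3 := Complex.add_conj z
  push_cast at h3
  rw [unitPart_apply]
  push_cast
  field_simp
  linear_combination z * h3 - h2

section

variable {f : ℂ → ℂ} {p q : ℂ[X]} {ι : Type*} {l : Filter ι} {g : ι → ℂ}

/-- Since `P z / z^n` tends to the leading coefficient and `unitPart` is multiplicative, the
direction of `P (g t)` follows that of `g t`. The power `N` removes the ambiguity among finitely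
many limiting directions. -/
theorem tendsto_unitPart_eval_pow {P : ℂ[X]} (hP : P ≠ 0) {N : ℕ} {W : ℂ} (hW : ‖W‖ = 1)
    (hg : Tendsto g l (Bornology.cobounded ℂ))
    (hgW : Tendsto (fun t => unitPart (g t) ^ N) l (𝓝 W)) :
    ∃ V, ‖V‖ = 1 ∧ Tendsto (fun t => unitPart (P.eval (g t)) ^ N) l (𝓝 V) := by
  have hlc := Polynomial.leadingCoeff_ne_zero.2 hP
  refine ⟨unitPart P.leadingCoeff ^ N * W ^ P.natDegree, ?_, ?_⟩
  · rw [norm_mul, norm_pow, norm_pow, norm_unitPart hlc, hW, one_pow, one_pow, one_mul]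
  · have h1 := (continuousAt_unitPart hlc).tendsto.comp
      ((Polynomial.tendsto_eval_div_pow_cobounded (P := P) le_rfl).comp hg)
    refine ((h1.pow N).mul (hgW.pow P.natDegree)).congr' ?_
    filter_upwards [hg.eventually (Bornology.eventually_ne_cobounded 0)] with t ht
    have h2 := pow_ne_zero N (pow_ne_zero P.natDegree ((map_ne_zero unitPart).2 ht))
    simp only [Function.comp_apply, map_div₀, map_pow]
    rw [← pow_mul] at h2
    rw [div_pow, ← pow_mul, ← pow_mul, mul_comm N, div_mul_cancel₀ _ h2]

theorem eventually_near_asymptoticValue (hp : p ≠ 0) (hq : 0 < q.natDegree)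
    (hf : ∀ z, HasDerivAt f (p.eval z * Complex.exp (q.eval z)) z) :
    ∃ M : ℝ, 0 ≤ M ∧ ∀ κ : ℝ, κ < 1 → ∀ ε : ℝ, 0 < ε → ∀ᶠ z in valleyFilter q κ,
      ∃ b ∈ asymptoticValues f, ‖b‖ ≤ M ∧ ‖f z - b‖ < ε := by
  obtain ⟨M, hM, h⟩ := exists_expansion hp hq hf
  refine ⟨M, hM, fun κ hκ ε hε => ?_⟩
  have h1 := (tendsto_mainTerm_valleyFilter p hq hκ).norm
  rw [norm_zero] at h1
  have h2 : ∀ᶠ z in valleyFilter q κ, 0 ≤ (negLead q z).re := by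
    refine Filter.Eventually.filter_mono inf_le_right ?_
    rw [eventually_principal]
    exact fun z hz => le_trans (by positivity) hz
  filter_upwards [(h 1 one_pos).filter_mono inf_le_left, h2,
    h1.eventually_lt_const (half_pos hε)] with z ⟨b, hbM, hb, hba⟩ h2 h3
  refine ⟨b, hba h2, hbM, ?_⟩
  have := norm_add_le (f z - b - mainTerm p q z) (mainTerm p q z)
  rw [sub_add_cancel] at this
  linarith

theorem eventually_norm_lt_norm (hp : p ≠ 0) (hq : 0 < q.natDegree)
    (hf : ∀ z, HasDerivAt f (p.eval z * Complex.exp (q.eval z)) z) {κ : ℝ} (hκ : κ < 1) :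
    ∀ᶠ z in valleyFilter (-q) κ, ‖z‖ < ‖f z‖ := by
  obtain ⟨M, hM, h⟩ := exists_expansion hp hq hf
  have h1 := (tendsto_div_mainTerm_valleyFilter_neg hp hq hκ).norm
  rw [norm_zero] at h1
  obtain ⟨R, hR, hmain⟩ := exists_forall_norm_ge_main hp hq one_pos
  have hn := tendsto_norm_cobounded_atTop (E := ℂ)
  filter_upwards [(h (1 / 2) (by norm_num)).filter_mono inf_le_left,
    h1.eventually_lt_const (by norm_num : (0 : ℝ) < 1 / 4),
    (hn.eventually_ge_atTop R).filter_mono inf_le_left,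
    (hn.eventually_gt_atTop M).filter_mono inf_le_left] with z ⟨b, hbM, hb, _⟩ h2 h3 h4
  obtain ⟨h5, h6, -⟩ := hmain z h3
  have h7 : mainTerm p q z ≠ 0 := mul_ne_zero (div_ne_zero h5 h6) (Complex.exp_ne_zero _)
  rw [norm_div, div_lt_iff₀ (norm_pos_iff.2 h7)] at h2
  have h8 := norm_sub_norm_le (mainTerm p q z) (-(f z - b - mainTerm p q z))
  have h9 : mainTerm p q z - -(f z - b - mainTerm p q z) = f z - b := by ring
  rw [norm_neg, h9] at h8
  have h10 := norm_sub_le (f z) b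
  linarith

/-- On a path to infinity that avoids the regions where the leading monomial of `q` has large real
part, the arguments of the path accumulate only at finitely many directions. -/
theorem exists_tendsto_unitPart_pow (hq : 0 < q.natDegree) {κ : ℝ} (hκ : 0 < κ)
    (hg : Tendsto g l (Bornology.cobounded ℂ))
    (h : ∀ᶠ t in l, |(negLead q (g t)).re| ≤ ‖g t‖ ^ q.natDegree * ‖g t‖ ^ (-κ)) :
    ∃ W, ‖W‖ = 1 ∧ Tendsto (fun t => unitPart (g t) ^ (2 * q.natDegree)) l (𝓝 W) := by
  have ha0 := Polynomial.leadingCoeff_ne_zero.2 (Polynomial.ne_zero_of_natDegree_gt hq)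
  have ha : 0 < ‖q.leadingCoeff‖ := norm_pos_iff.2 ha0
  have hne := hg.eventually (Bornology.eventually_ne_cobounded 0)
  have h0 : ∀ᶠ t in l, negLead q (g t) ≠ 0 := by
    filter_upwards [hne] with t ht
    exact neg_ne_zero.2 (mul_ne_zero ha0 (pow_ne_zero _ ht))
  have h1 : Tendsto (fun t => (negLead q (g t)).re / ‖negLead q (g t)‖) l (𝓝 0) := by
    have h2 := (((tendsto_rpow_neg_atTop hκ).comp (tendsto_norm_cobounded_atTop (E := ℂ))).comp
      hg).const_mul ‖q.leadingCoeff‖⁻¹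
    rw [mul_zero] at h2
    refine squeeze_zero_norm' ?_ h2
    filter_upwards [h, hne] with t ht ht0
    have := norm_pos_iff.2 ht0
    rw [norm_negLead, Real.norm_eq_abs, abs_div, abs_of_pos (a := ‖q.leadingCoeff‖ * _)
      (by positivity), div_le_iff₀ (by positivity)]
    refine ht.trans_eq ?_
    simp only [Function.comp_apply]
    field_simp
  have h2 : Tendsto (fun t => unitPart (negLead q (g t)) ^ 2) l (𝓝 (-1)) := by
    have h3 : Tendsto (fun t => 2 * (((negLead q (g t)).re / ‖negLead q (g t)‖ : ℝ) : ℂ) *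
        unitPart (negLead q (g t))) l (𝓝 0) := by
      have h4 := (h1.norm.const_mul 2)
      rw [norm_zero, mul_zero] at h4
      refine squeeze_zero_norm' ?_ h4
      filter_upwards [h0] with t ht
      rw [norm_mul, norm_mul, norm_unitPart ht, Complex.norm_real]
      simp
    have h4 := h3.sub_const 1
    rw [zero_sub] at h4
    exact h4.congr' (h0.mono fun t ht => (unitPart_sq ht).symm)
  have hu : unitPart (-q.leadingCoeff) ≠ 0 := (map_ne_zero _).2 (neg_ne_zero.2 ha0)
  refine ⟨-1 / unitPart (-q.leadingCoeff) ^ 2, ?_, ?_⟩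
  · rw [norm_div, norm_pow, norm_unitPart (neg_ne_zero.2 ha0)]
    simp
  · refine (h2.div_const _).congr fun t => ?_
    rw [negLead, ← neg_mul, map_mul, map_pow, mul_pow, mul_div_cancel_left₀ _ (pow_ne_zero _ hu),
      ← pow_mul, mul_comm]

/-- In the strips `Re q` is small compared with `‖z‖^d`, while `‖q z‖` is at least a constant times
`‖z‖^d`; the imaginary part must supply the difference. -/
theorem tendsto_abs_im_eval (hq : 0 < q.natDegree) {κ : ℝ} (hκ : 0 < κ)
    (hg : Tendsto g l (Bornology.cobounded ℂ))
    (h : ∀ᶠ t in l, |(negLead q (g t)).re| ≤ ‖g t‖ ^ q.natDegree * ‖g t‖ ^ (-κ)) :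
    Tendsto (fun t => |(q.eval (g t)).im|) l atTop := by
  have ha0 := Polynomial.leadingCoeff_ne_zero.2 (Polynomial.ne_zero_of_natDegree_gt hq)
  have ha : 0 < ‖q.leadingCoeff‖ := norm_pos_iff.2 ha0
  have hn := (tendsto_norm_cobounded_atTop (E := ℂ)).comp hg
  obtain ⟨C, hC, h1⟩ := exists_re_eval_add_le q
  have h2 := (Polynomial.tendsto_eval_div_pow_cobounded (P := q) le_rfl).norm.eventually_const_le
    (half_lt_self ha : _ < ‖q.coeff q.natDegree‖)
  refine tendsto_atTop_mono' l ?_ (hn.const_mul_atTop (by positivity : 0 < ‖q.leadingCoeff‖ / 4))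
  filter_upwards [h, hg.eventually h1, hg.eventually h2,
    hg.eventually (eventually_mul_norm_pow_le (by positivity : 0 < ‖q.leadingCoeff‖ / 8) hκ
      q.natDegree),
    hn.eventually_ge_atTop 1, hn.eventually_ge_atTop (8 * C / ‖q.leadingCoeff‖)]
    with t h3 h4 h5 h6 h7 h8
  simp only [Function.comp_apply] at h7 h8 ⊢
  have hz : 0 < ‖g t‖ := one_pos.trans_le h7
  rw [norm_div, norm_pow, le_div_iff₀ (by positivity)] at h5
  change ‖q.leadingCoeff‖ / 2 * _ ≤ _ at h5
  rw [div_le_iff₀ ha] at h8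
  have h9 : C * ‖g t‖ ^ (q.natDegree - 1) ≤ ‖q.leadingCoeff‖ / 8 * ‖g t‖ ^ q.natDegree := by
    have h10 : ‖g t‖ ^ q.natDegree = ‖g t‖ ^ (q.natDegree - 1) * ‖g t‖ := by
      rw [← pow_succ, Nat.sub_add_cancel hq]
    rw [h10]
    have : 0 < ‖g t‖ ^ (q.natDegree - 1) := by positivity
    nlinarith
  have h10 : ‖g t‖ ≤ ‖g t‖ ^ q.natDegree := le_self_pow₀ h7 hq.ne'
  have h11 := Complex.norm_le_abs_re_add_abs_im (q.eval (g t))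
  have h12 := abs_sub_abs_le_abs_sub (q.eval (g t)).re (-(negLead q (g t)).re)
  rw [abs_neg, sub_neg_eq_add] at h12
  nlinarith

/-- The asymptotic values of `f` form a bounded set. -/
theorem isBounded_asymptoticValues (hp : p ≠ 0) (hq : 0 < q.natDegree)
    (hf : ∀ z, HasDerivAt f (p.eval z * Complex.exp (q.eval z)) z) :
    Bornology.IsBounded (asymptoticValues f) := by
  obtain ⟨M₁, hM₁, hexp⟩ := exists_expansion hp hq hf
  obtain ⟨M₂, hM₂, hnear⟩ := eventually_near_asymptoticValue hp hq hf
  have hpow : ∀ᶠ x : ℂ in 𝓝 1, 0 < (x ^ (2 * q.natDegree)).re :=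
    ContinuousAt.eventually_lt (f := fun _ => (0 : ℝ)) (by fun_prop)
      (Complex.continuous_re.comp (continuous_pow _)).continuousAt (by simp)
  obtain ⟨δ, hδ, hpow⟩ := Metric.eventually_nhds_iff.1 hpow
  -- Beyond `M₂ + 2`, `A` is too far from the values of `f` in the valleys; the other two bounds
  -- force the main term to lie within `δ ‖A‖` of `A`.
  refine isBounded_iff_forall_norm_le.2 ⟨max (M₂ + 2) (max (M₁ + 1) (4 * (1 + M₁) / δ)), ?_⟩
  rintro A ⟨γ, hγc, hγ, hA⟩
  by_contra! hcon
  obtain ⟨hA1, hcon⟩ := max_lt_iff.1 hcon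
  obtain ⟨hA2, hA3⟩ := max_lt_iff.1 hcon
  have hA0 : 0 < ‖A‖ := by linarith
  have hA0' : A ≠ 0 := norm_pos_iff.1 hA0
  have hfA : ∀ᶠ t in 𝓝[<] (1 : ℝ), ‖f (γ t) - A‖ < 1 := by
    simpa [dist_eq_norm] using Metric.tendsto_nhds.1 hA 1 one_pos
  have hhalf : (1 / 2 : ℝ) < 1 := by norm_num
  have hstrip : ∀ᶠ t in 𝓝[<] (1 : ℝ),
      |(negLead q (γ t)).re| ≤ ‖γ t‖ ^ q.natDegree * ‖γ t‖ ^ (-(1 / 2) : ℝ) := by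
    have h1 := hnear (1 / 2) hhalf 1 one_pos
    have h2 := eventually_norm_lt_norm hp hq hf hhalf
    rw [valleyFilter, eventually_inf_principal] at h1 h2
    filter_upwards [hγ.eventually h1, hγ.eventually h2, hfA,
      ((tendsto_norm_cobounded_atTop (E := ℂ)).comp hγ).eventually_ge_atTop (‖A‖ + 1)]
      with t h1 h2 h3 h4
    rw [Function.comp_apply] at h4
    rw [abs_le]
    constructor
    · by_contra! h5
      have h6 := h2 (by
        rw [Polynomial.natDegree_neg, negLead_neg, Complex.neg_re]
        linarith)
      have h7 := norm_sub_norm_le (f (γ t)) A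
      linarith
    · by_contra! h5
      obtain ⟨b, -, hb, hb'⟩ := h1 h5.le
      have h6 := norm_sub_norm_le A b
      have h7 := norm_sub_le_norm_sub_add_norm_sub A (f (γ t)) b
      rw [norm_sub_rev A (f (γ t))] at h7
      linarith
  obtain ⟨W, hW, hWt⟩ := exists_tendsto_unitPart_pow hq (by norm_num) hγ hstrip
  obtain ⟨V₁, hV₁, hp'⟩ := tendsto_unitPart_eval_pow hp hW hγ hWt
  obtain ⟨V₂, hV₂, hq'⟩ := tendsto_unitPart_eval_pow (derivative_ne_zero_of_natDegree_pos hq)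
    hW hγ hWt
  have hV₁0 : V₁ ≠ 0 := norm_pos_iff.1 (hV₁ ▸ one_pos)
  have hV₂0 : V₂ ≠ 0 := norm_pos_iff.1 (hV₂ ▸ one_pos)
  have hre : ∀ᶠ t in 𝓝[<] (1 : ℝ),
      0 < (unitPart (mainTerm p q (γ t) / A) ^ (2 * q.natDegree)).re := by
    filter_upwards [hγ.eventually (hexp (min (1 / 2) (δ / 16)) (by positivity)), hfA]
      with t ⟨b, hbM, hb, _⟩ h1
    set G := mainTerm p q (γ t)
    have h2 : ‖G - A‖ ≤ min (1 / 2) (δ / 16) * ‖G‖ + 1 + M₁ := by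
      have h3 : G - A = -(f (γ t) - b - G) + (f (γ t) - A) - b := by ring
      have h4 := norm_sub_le (-(f (γ t) - b - G) + (f (γ t) - A)) b
      have h5 := norm_add_le (-(f (γ t) - b - G)) (f (γ t) - A)
      rw [norm_neg] at h5
      rw [h3]
      linarith
    have h3 := norm_sub_norm_le G A
    have h4 := norm_nonneg G
    have h5 := mul_le_mul_of_nonneg_right (min_le_left (1 / 2) (δ / 16)) h4
    have h6 := mul_le_mul_of_nonneg_right (min_le_right (1 / 2) (δ / 16)) h4
    have h7 : ‖G‖ ≤ 4 * ‖A‖ := by linarith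
    rw [div_lt_iff₀ hδ] at hA3
    have h8 : dist (G / A) 1 < δ := by
      rw [dist_eq_norm, div_sub_one hA0', norm_div, div_lt_iff₀ hA0]
      nlinarith
    have h9 := hpow h8
    have h10 : G / A ≠ 0 := by
      intro h
      rw [h] at h9
      simp [hq.ne'] at h9
    rw [← map_pow, unitPart_apply, Complex.div_ofReal_re]
    exact div_pos h9 (norm_pos_iff.2 (pow_ne_zero _ h10))
  -- The phase is chosen so that whenever the `2d`-th power of the direction of `e^q` equals `-X`,
  -- that of `G / A` is near `-1`, against `hre`.
  set X := unitPart A ^ (2 * q.natDegree) * V₂ / V₁ with hX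
  have hX0 : X ≠ 0 := div_ne_zero
    (mul_ne_zero (pow_ne_zero _ ((map_ne_zero _).2 hA0')) hV₂0) hV₁0
  have hX1 : ‖X‖ = 1 := by
    rw [hX, norm_div, norm_mul, norm_pow, norm_unitPart hA0', hV₁, hV₂]
    simp
  have hlim : Tendsto (fun t => -X / (unitPart A ^ (2 * q.natDegree) *
      unitPart (q.derivative.eval (γ t)) ^ (2 * q.natDegree) /
        unitPart (p.eval (γ t)) ^ (2 * q.natDegree))) (𝓝[<] 1) (𝓝 (-1)) := by
    have h1 := (tendsto_const_nhds (x := -X)).div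
      ((hq'.const_mul (unitPart A ^ (2 * q.natDegree))).div hp' hV₁0) hX0
    rwa [← hX, neg_div, div_self hX0] at h1
  have hneg : ∀ᶠ t in 𝓝[<] (1 : ℝ), (-X / (unitPart A ^ (2 * q.natDegree) *
      unitPart (q.derivative.eval (γ t)) ^ (2 * q.natDegree) /
        unitPart (p.eval (γ t)) ^ (2 * q.natDegree))).re < 0 :=
    ((Complex.continuous_re.tendsto _).comp hlim).eventually_lt_const (by simp)
  have hNpos : (0 : ℝ) < 2 * q.natDegree := by
    have : (0 : ℝ) < q.natDegree := by exact_mod_cast hq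
    linarith
  have hfreq := frequently_eq_add_two_pi_mul_of_tendsto_abs
    (h := fun t => 2 * q.natDegree * (q.eval (γ t)).im)
    (continuousOn_const.mul (Complex.continuous_im.comp_continuousOn
      (q.continuous.comp_continuousOn hγc)))
    (by
      simp only [abs_mul _ (Polynomial.eval _ q).im, abs_of_pos hNpos]
      exact (tendsto_abs_im_eval hq (by norm_num) hγ hstrip).const_mul_atTop hNpos)
    (Complex.arg (-X))
  obtain ⟨t, ⟨k, hk⟩, ⟨hre, hneg⟩, hpt, hqt⟩ := (hfreq.and_eventually ((hre.and hneg).and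
    ((hγ.eventually (Polynomial.eventually_eval_ne_zero_cobounded hp)).and
    (hγ.eventually (Polynomial.eventually_eval_ne_zero_cobounded
      (derivative_ne_zero_of_natDegree_pos hq)))))).exists
  have hexpX : unitPart (Complex.exp (q.eval (γ t))) ^ (2 * q.natDegree) = -X := by
    rw [unitPart_exp, ← Complex.exp_nat_mul]
    have h1 : ((2 * q.natDegree : ℕ) : ℂ) * ((q.eval (γ t)).im * Complex.I) =
        ((2 * q.natDegree * (q.eval (γ t)).im : ℝ) : ℂ) * Complex.I := by
      push_cast
      ring
    have h2 : ((Complex.arg (-X) + 2 * Real.pi * k : ℝ) : ℂ) * Complex.I =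
        Complex.arg (-X) * Complex.I + k * (2 * Real.pi * Complex.I) := by
      push_cast
      ring
    have h3 := Complex.norm_mul_exp_arg_mul_I (-X)
    rw [norm_neg, hX1, Complex.ofReal_one, one_mul] at h3
    rw [h1, hk, h2, Complex.exp_add, Complex.exp_int_mul_two_pi_mul_I, mul_one, h3]
  have h1 : unitPart (mainTerm p q (γ t) / A) ^ (2 * q.natDegree) =
      -X / (unitPart A ^ (2 * q.natDegree) *
      unitPart (q.derivative.eval (γ t)) ^ (2 * q.natDegree) /
        unitPart (p.eval (γ t)) ^ (2 * q.natDegree)) := by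
    have e1 := pow_ne_zero (2 * q.natDegree) ((map_ne_zero unitPart).2 hA0')
    have e2 := pow_ne_zero (2 * q.natDegree) ((map_ne_zero unitPart).2 hpt)
    have e3 := pow_ne_zero (2 * q.natDegree) ((map_ne_zero unitPart).2 hqt)
    rw [← hexpX, mainTerm, map_div₀, map_mul, map_div₀, div_pow, mul_pow, div_pow]
    generalize unitPart A ^ (2 * q.natDegree) = x1 at *
    generalize unitPart (p.eval (γ t)) ^ (2 * q.natDegree) = x2 at *
    generalize unitPart (q.derivative.eval (γ t)) ^ (2 * q.natDegree) = x3 at *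
    field_simp
  rw [h1] at hre
  exact lt_asymm hre hneg

theorem isBounded_singularValues (hp : p ≠ 0) (hq : 0 < q.natDegree)
    (hf : ∀ z, HasDerivAt f (p.eval z * Complex.exp (q.eval z)) z) :
    Bornology.IsBounded (singularValues f) :=
  ((finite_criticalValues hp hf).isBounded.union (isBounded_asymptoticValues hp hq hf)).closure

end

/-! ### Logarithmic area of the strips -/

theorem volume_abs_cos_mul_add_le (d : ℕ) (hd : 0 < d) {α : ℝ} (hα : |α| ≤ Real.pi) (t : ℝ) :
    (volume.restrict (Set.Ioo (-Real.pi) Real.pi)) {θ : ℝ | |Real.cos (d * θ + α)| ≤ t} ≤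
      ENNReal.ofReal ((2 * d + 5) * (Real.pi * t)) := by
  have hπ := Real.pi_pos
  have hd1 : (1 : ℝ) ≤ d := by exact_mod_cast hd
  rw [Measure.restrict_apply' measurableSet_Ioo]
  -- Near its closest zero, indexed by `k`, the cosine is at least `2/π` times the distance in
  -- absolute value. From `|y| ≤ dπ + π + π/2` and a rounding error of at most `π/2` come `|k| ≤ d +
  -- 2` and the count `2d + 5`.
  have hsub : {θ : ℝ | |Real.cos (d * θ + α)| ≤ t} ∩ Set.Ioo (-Real.pi) Real.pi ⊆
      ⋃ k ∈ Finset.Icc (-(d + 2 : ℤ)) (d + 2),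
        Metric.closedBall ((k * Real.pi - α - Real.pi / 2) / d) (Real.pi / 2 * t) := by
    rintro θ ⟨hθ, hθπ⟩
    rw [Set.mem_ofPred_eq] at hθ
    set y := d * θ + α + Real.pi / 2 with hy
    set k := round (y / Real.pi) with hk
    have h1 : |y - k * Real.pi| ≤ Real.pi / 2 := by
      have h2 := abs_sub_round (y / Real.pi)
      have h3 : y - k * Real.pi = (y / Real.pi - k) * Real.pi := by field_simp
      rw [h3, abs_mul, abs_of_pos hπ]
      nlinarith
    have h2 : |y - k * Real.pi| ≤ Real.pi / 2 * t := by
      have h3 := Real.mul_abs_le_abs_sin h1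
      rw [Real.sin_sub_int_mul_pi, abs_mul, abs_neg_one_zpow, one_mul, hy,
        Real.sin_add_pi_div_two] at h3
      have h4 := h3.trans hθ
      rw [div_mul_eq_mul_div, div_le_iff₀ hπ] at h4
      linarith
    have h3 : |θ| < Real.pi := abs_lt.2 hθπ
    have h4 : |(k : ℝ)| * Real.pi ≤ (d + 2) * Real.pi := by
      have h5 : |(k : ℝ) * Real.pi| ≤ |y| + |y - k * Real.pi| := by
        have := abs_sub_abs_le_abs_sub (k * Real.pi) y
        rw [abs_sub_comm] at this
        linarith
      have h6 : |y| ≤ d * |θ| + |α| + Real.pi / 2 := by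
        refine (abs_add_le _ _).trans ?_
        rw [abs_of_pos (by positivity : 0 < Real.pi / 2)]
        gcongr
        refine (abs_add_le _ _).trans ?_
        rw [abs_mul, Nat.abs_cast]
      rw [abs_mul, abs_of_pos hπ] at h5
      nlinarith
    have h5 : |(k : ℝ)| ≤ d + 2 := le_of_mul_le_mul_right h4 hπ
    have h6 : |k| ≤ (d + 2 : ℤ) := by exact_mod_cast h5
    rw [Set.mem_iUnion₂]
    refine ⟨k, Finset.mem_Icc.2 (abs_le.1 h6), ?_⟩
    rw [Metric.mem_closedBall, Real.dist_eq]
    have h7 : θ - (k * Real.pi - α - Real.pi / 2) / d = (y - k * Real.pi) / d := by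
      rw [hy]
      field_simp
      ring
    rw [h7, abs_div, Nat.abs_cast]
    exact (div_le_self (abs_nonneg _) hd1).trans h2
  refine (measure_mono hsub).trans ((measure_biUnion_finset_le _ _).trans ?_)
  simp only [Real.volume_closedBall, Finset.sum_const, Int.card_Icc]
  rw [← ENNReal.ofReal_nsmul, nsmul_eq_mul]
  refine ENNReal.ofReal_le_ofReal (le_of_eq ?_)
  have h1 : ((d + 2 + 1 - -(d + 2 : ℤ)).toNat : ℤ) = 2 * d + 5 := by omega
  have h2 : ((d + 2 + 1 - -(d + 2 : ℤ)).toNat : ℝ) = 2 * d + 5 := by exact_mod_cast h1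
  rw [h2]
  ring

theorem re_negLead_polar (q : ℂ[X]) (r θ : ℝ) :
    (negLead q (r * (Real.cos θ + Real.sin θ * Complex.I))).re =
      -(‖q.leadingCoeff‖ * r ^ q.natDegree *
        Real.cos (q.natDegree * θ + Complex.arg q.leadingCoeff)) := by
  have h1 : negLead q (r * (Real.cos θ + Real.sin θ * Complex.I)) =
      ((-(‖q.leadingCoeff‖ * r ^ q.natDegree) : ℝ) : ℂ) *
        Complex.exp ((q.natDegree * θ + Complex.arg q.leadingCoeff : ℝ) * Complex.I) := by
    have h2 : (Real.cos θ + Real.sin θ * Complex.I : ℂ) = Complex.exp (θ * Complex.I) := by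
      rw [Complex.exp_mul_I, Complex.ofReal_cos, Complex.ofReal_sin]
    rw [negLead, h2, mul_pow, ← Complex.exp_nat_mul]
    conv_lhs => rw [← Complex.norm_mul_exp_arg_mul_I q.leadingCoeff]
    push_cast
    rw [add_mul, Complex.exp_add]
    ring_nf
  rw [h1, Complex.re_ofReal_mul, Complex.exp_ofReal_mul_I_re]
  ring

theorem setLIntegral_Ici_rpow_le {κ C ρ : ℝ} (hκ : 0 < κ) (hC : 0 ≤ C) (hρ : 0 < ρ) :
    ∫⁻ r in Set.Ici ρ, ENNReal.ofReal (C * r ^ (-κ - 1)) ≤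
      ENNReal.ofReal (C / κ * ρ ^ (-κ)) := by
  rw [setLIntegral_congr Ioi_ae_eq_Ici.symm, ← ofReal_integral_eq_lintegral_ofReal
    ((integrableOn_Ioi_rpow_of_lt (by linarith) hρ).const_mul C)]
  · rw [integral_const_mul, integral_Ioi_rpow_of_lt (by linarith) hρ]
    refine ENNReal.ofReal_le_ofReal (le_of_eq ?_)
    rw [sub_add_cancel]
    field_simp
  · filter_upwards [ae_restrict_mem measurableSet_Ioi] with r hr
    have : 0 < r := hρ.trans hr
    positivity

/-- The strips around the curves where the leading monomial of `q` is imaginary have small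
logarithmic area near infinity. -/
theorem exists_lintegral_strip_le {q : ℂ[X]} (hq : 0 < q.natDegree) {κ : ℝ} (hκ : 0 < κ) :
    ∃ C : ℝ, 0 ≤ C ∧ ∀ ρ : ℝ, 0 < ρ →
      ∫⁻ z in {z : ℂ | ρ ≤ ‖z‖ ∧ |(negLead q z).re| ≤ ‖z‖ ^ q.natDegree * ‖z‖ ^ (-κ)},
        ENNReal.ofReal (1 / ‖z‖ ^ 2) ≤ ENNReal.ofReal (C * ρ ^ (-κ)) := by
  have hπ := Real.pi_pos
  have ha : 0 < ‖q.leadingCoeff‖ :=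
    norm_pos_iff.2 (Polynomial.leadingCoeff_ne_zero.2 (Polynomial.ne_zero_of_natDegree_gt hq))
  set C := (2 * q.natDegree + 5) * Real.pi / ‖q.leadingCoeff‖ with hC
  have hC0 : 0 ≤ C := by positivity
  refine ⟨C / κ, by positivity, fun ρ hρ => ?_⟩
  set S := {z : ℂ | ρ ≤ ‖z‖ ∧ |(negLead q z).re| ≤ ‖z‖ ^ q.natDegree * ‖z‖ ^ (-κ)} with hS
  have hSm : MeasurableSet S := by
    have h1 : Measurable fun z => |(negLead q z).re| :=
      (continuous_abs.comp (Complex.continuous_re.comp (continuous_negLead q))).measurable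
    exact (measurableSet_le measurable_const measurable_norm).inter
      (measurableSet_le h1 (by fun_prop))
  set T := {x : ℝ × ℝ | ρ ≤ x.1 ∧
    |Real.cos (q.natDegree * x.2 + Complex.arg q.leadingCoeff)| ≤
      x.1 ^ (-κ) / ‖q.leadingCoeff‖} with hT
  have hTm : MeasurableSet T := by
    have h1 : Measurable fun x : ℝ × ℝ =>
        |Real.cos (q.natDegree * x.2 + Complex.arg q.leadingCoeff)| :=
      Continuous.measurable (by fun_prop)
    exact (measurableSet_le measurable_const measurable_fst).inter
      (measurableSet_le h1 (by fun_prop))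
  -- In polar coordinates the measure `dx dy / |z|²` is `dr dθ / r`, and the strip becomes a bound
  -- on a cosine at each radius.
  rw [← lintegral_indicator hSm, ← Complex.lintegral_comp_polarCoord_symm]
  calc ∫⁻ x in polarCoord.target, ENNReal.ofReal x.1 •
        S.indicator (fun z => ENNReal.ofReal (1 / ‖z‖ ^ 2)) (Complex.polarCoord.symm x)
      ≤ ∫⁻ x in polarCoord.target, T.indicator (fun x => ENNReal.ofReal (1 / x.1)) x := by
        refine setLIntegral_mono' polarCoord.open_target.measurableSet fun x hx => ?_
        rw [polarCoord_target] at hx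
        have hr : 0 < x.1 := hx.1
        have hn : ‖Complex.polarCoord.symm x‖ = x.1 := by
          rw [Complex.norm_polarCoord_symm, abs_of_pos hr]
        by_cases hxS : Complex.polarCoord.symm x ∈ S
        · have hxT : x ∈ T := by
            obtain ⟨h1, h2⟩ := hxS
            rw [hn] at h1 h2
            refine ⟨h1, ?_⟩
            rw [Complex.polarCoord_symm_apply, re_negLead_polar, abs_neg, abs_mul,
              abs_of_pos (by positivity)] at h2
            rw [le_div_iff₀ ha]
            have h3 : 0 < x.1 ^ q.natDegree := by positivity
            refine le_of_mul_le_mul_left ?_ h3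
            linarith
          rw [Set.indicator_of_mem hxS, Set.indicator_of_mem hxT, hn, smul_eq_mul,
            ← ENNReal.ofReal_mul hr.le]
          refine ENNReal.ofReal_le_ofReal (le_of_eq ?_)
          field_simp
        · rw [Set.indicator_of_notMem hxS, smul_zero]
          exact zero_le
    _ = ∫⁻ r in Set.Ioi (0 : ℝ), ∫⁻ θ in Set.Ioo (-Real.pi) Real.pi,
          T.indicator (fun x => ENNReal.ofReal (1 / x.1)) (r, θ) := by
        rw [polarCoord_target, Measure.volume_eq_prod, ← Measure.prod_restrict]
        refine lintegral_prod _ (Measurable.aemeasurable ?_)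
        exact Measurable.indicator (by fun_prop) hTm
    _ ≤ ∫⁻ r in Set.Ioi (0 : ℝ), (Set.Ici ρ).indicator
          (fun r => ENNReal.ofReal (C * r ^ (-κ - 1))) r := by
        refine setLIntegral_mono' measurableSet_Ioi fun r hr => ?_
        have hr0 : 0 < r := hr
        by_cases hρr : ρ ≤ r
        · rw [Set.indicator_of_mem (Set.mem_Ici.2 hρr)]
          have h1 : ∀ θ, T.indicator (fun x => ENNReal.ofReal (1 / x.1)) (r, θ) ≤
              {θ : ℝ | |Real.cos (q.natDegree * θ + Complex.arg q.leadingCoeff)| ≤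
                r ^ (-κ) / ‖q.leadingCoeff‖}.indicator (fun _ => ENNReal.ofReal (1 / r)) θ := by
            intro θ
            by_cases h : (r, θ) ∈ T
            · rw [Set.indicator_of_mem h, Set.indicator_of_mem (by exact h.2)]
            · rw [Set.indicator_of_notMem h]
              exact zero_le
          refine (lintegral_mono h1).trans ?_
          rw [lintegral_indicator_const (measurableSet_le
            (Continuous.measurable (by fun_prop)) measurable_const)]
          refine (mul_le_mul_right (volume_abs_cos_mul_add_le q.natDegree hq
            (Complex.abs_arg_le_pi _) _) _).trans ?_
          rw [← ENNReal.ofReal_mul (by positivity)]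
          refine ENNReal.ofReal_le_ofReal (le_of_eq ?_)
          rw [hC, Real.rpow_sub_one hr0.ne']
          field_simp
        · rw [Set.indicator_of_notMem (by simpa using hρr)]
          refine le_of_eq (lintegral_eq_zero_of_ae_eq_zero ?_)
          exact Eventually.of_forall fun θ => Set.indicator_of_notMem (fun h => hρr h.1) _
    _ ≤ ∫⁻ r in Set.Ici ρ, ENNReal.ofReal (C * r ^ (-κ - 1)) := by
        rw [← lintegral_indicator measurableSet_Ici]
        exact setLIntegral_le_lintegral _ _
    _ ≤ _ := setLIntegral_Ici_rpow_le hκ hC0 hρ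

/-! ### Area estimate and conclusion -/

section

variable {f : ℂ → ℂ} {p q : ℂ[X]}

/-- The cylindrical area of `f` outside a neighbourhood of the singular values decays faster than
every power `ρ ^ (-κ)` with `κ < 1`. -/
theorem exists_cylindricalArea_le (hp : p ≠ 0) (hq : 0 < q.natDegree)
    (hf : ∀ z, HasDerivAt f (p.eval z * Complex.exp (q.eval z)) z) {D : Set ℂ} (hD : IsOpen D)
    (hSD : singularValues f ⊆ D) {κ : ℝ} (hκ0 : 0 < κ) (hκ1 : κ < 1) :
    ∃ C : ℝ, 0 ≤ C ∧ ∀ᶠ ρ : ℝ in atTop,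
      cylindricalArea f D ρ ≤ ENNReal.ofReal (C * ρ ^ (-κ)) := by
  -- Compactness supplies one `ε` such that every point within `ε` of a singular value is in `D`.
  have hcomp : IsCompact (singularValues f) :=
    Metric.isCompact_of_isClosed_isBounded isClosed_closure (isBounded_singularValues hp hq hf)
  obtain ⟨ε, hε, hεD⟩ := hcomp.exists_thickening_subset_open hD hSD
  obtain ⟨M, -, hnear⟩ := eventually_near_asymptoticValue hp hq hf
  have h1 := hnear κ hκ1 ε hε
  have h2 := eventually_norm_lt_norm hp hq hf hκ1
  rw [valleyFilter, eventually_inf_principal] at h1 h2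
  obtain ⟨R, -, hR⟩ := (hasBasis_cobounded_norm (E := ℂ)).eventually_iff.1 (h1.and h2)
  obtain ⟨C, hC, hstrip⟩ := exists_lintegral_strip_le hq hκ0
  refine ⟨1 / (2 * Real.pi) * C, by positivity, ?_⟩
  filter_upwards [eventually_gt_atTop 0, eventually_ge_atTop R] with ρ hρ hρR
  rw [cylindricalArea, mul_assoc, ENNReal.ofReal_mul (by positivity)]
  refine mul_le_mul_right ((lintegral_mono_set ?_).trans (hstrip ρ hρ)) _
  rintro z ⟨hz, hfz, hfD⟩
  rw [Set.mem_ofPred_eq] at hz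
  rw [mem_closedBall_zero_iff] at hfz
  obtain ⟨h3, h4⟩ := hR (hρR.trans hz)
  refine ⟨hz, abs_le.2 ⟨?_, ?_⟩⟩
  · by_contra! h5
    have h6 := h4 (by
      rw [Set.mem_ofPred_eq, Polynomial.natDegree_neg, negLead_neg, Complex.neg_re]
      linarith)
    linarith
  · by_contra! h5
    obtain ⟨b, hb, -, hb'⟩ := h3 h5.le
    refine hfD (hεD (Metric.mem_thickening_iff.2 ⟨b, subset_closure (Or.inr hb), ?_⟩))
    rwa [dist_eq_norm]

theorem hasAAP_of_hasDerivAt (hp : p ≠ 0) (hq : 0 < q.natDegree)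
    (hf : ∀ z, HasDerivAt f (p.eval z * Complex.exp (q.eval z)) z) : HasAAP f := by
  refine ⟨⟨isTranscendentalEntire_of_hasDerivAt hp hq hf, isBounded_singularValues hp hq hf⟩,
    fun D hD hSD => ?_⟩
  -- Any exponent in `(0, 1)` would do, since only boundedness of `ρ^(-κ)` for `ρ ≥ 1` is needed.
  obtain ⟨C, hC, h⟩ := exists_cylindricalArea_le hp hq hf hD hSD (by norm_num : (0 : ℝ) < 1 / 2)
    (by norm_num)
  refine (limsup_le_of_le (by isBoundedDefault) ?_ : _ ≤ ENNReal.ofReal C).trans_lt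
    ENNReal.ofReal_lt_top
  filter_upwards [h, eventually_ge_atTop 1] with ρ h1 h2
  refine h1.trans (ENNReal.ofReal_le_ofReal (mul_le_of_le_one_right hC ?_))
  exact Real.rpow_le_one_of_one_le_of_nonpos h2 (by norm_num)

theorem isDegenerationFunction_of_hasDerivAt (hp : p ≠ 0) (hq : 0 < q.natDegree)
    (hf : ∀ z, HasDerivAt f (p.eval z * Complex.exp (q.eval z)) z) {κ : ℝ} (hκ0 : 0 < κ)
    (hκ1 : κ < 1) : IsDegenerationFunction f fun ρ => ρ ^ (-κ) := by
  refine ⟨hasAAP_of_hasDerivAt hp hq hf, fun ρ hρ => Real.rpow_pos_of_pos hρ _,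
    fun D hD hSD => ?_⟩
  obtain ⟨C, hC, h⟩ := exists_cylindricalArea_le hp hq hf hD hSD hκ0 hκ1
  refine (limsup_le_of_le (by isBoundedDefault) ?_ : _ ≤ ENNReal.ofReal C).trans_lt
    ENNReal.ofReal_lt_top
  filter_upwards [h] with ρ h1
  rw [ENNReal.ofReal_mul hC] at h1
  exact ENNReal.div_le_of_le_mul h1

end

end StructFinite

theorem mainTheorem9 (f : ℂ → ℂ) (hf : StructFinite.IsStructurallyFinite f) :
    StructFinite.HasAAP f ∧
      ∀ κ : ℝ, 0 < κ → κ < 1 →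
        StructFinite.IsDegenerationFunction f (fun ρ : ℝ => ρ ^ (-κ)) := by
  obtain ⟨C, p, q, hp, hq, hfeq⟩ := hf
  obtain rfl : f = StructFinite.primitiveFn C p q := funext hfeq
  exact ⟨StructFinite.hasAAP_of_hasDerivAt hp hq (StructFinite.hasDerivAt_primitiveFn C p q),
    fun κ hκ0 hκ1 => StructFinite.isDegenerationFunction_of_hasDerivAt hp hq
      (StructFinite.hasDerivAt_primitiveFn C p q) hκ0 hκ1⟩
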